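/- Let $\mathcal O$ be a discrete valuation ring with uniformizer $\varpi$ and field of fractions $F$ (for instance, the ring of integers of a non-archimedean local field $F$), and let $V$ be a finite-dimensional $F$-vector space with a decomposition $V=W_1\oplus W_2$ into nonzero subspaces. A lattice in $V$ is a finitely generated $\mathcal O$-submodule $\Lambda\subset V$ that spans $V$ over $F$; its homothety class is $[\Lambda]=\{a\Lambda : a\in F^\times\}$. Let $\mathcal B_e\mathrm{GL}(V)$ be the simplicial complex whose vertices are the homothety classes of lattices and whose simplices are the nonempty finite sets of pairwise incident vertices, where $\lambda_1,\lambda_2$ are incident if there are $\Lambda_i\in\lambda_i$ with $\varpi\Lambda_1\subset\Lambda_2\subset\Lambda_1$. A frame of a subspace $W\subset V$ is a set of linearly independent lines whose sum is $W$. For a frame $\mathcal F$ of $V$, the apartment $\mathcal A_{\mathcal F}$ is the full subcomplex of $\mathcal B_e\mathrm{GL}(V)$ on the vertices $[\bigoplus_{l\in\mathcal F}\mathcal O e_l]$ with $0\neq e_l\in l$. Put $$\overline{\mathcal A_{\mathcal F_1\cup\mathcal F_2}}=\bigcup_{\mathcal F_1,\ \mathcal F_2}\mathcal A_{\mathcal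 F_1\cup\mathcal F_2},$$ the union over all frames $\mathcal F_1$ of $W_1$ and $\mathcal F_2$ of $W_2$. Then $\overline{\mathcal A_{\mathcal F_1\cup\mathcal F_2}}$ is a subbuilding of $\mathcal B_e\mathrm{GL}(V)$: each $\mathcal A_{\mathcal F_1\cup\mathcal F_2}$ is an apartment of $\mathcal B_e\mathrm{GL}(V)$, and $\overline{\mathcal A_{\mathcal F_1\cup\mathcal F_2}}$ is a (not necessarily thick) building with the $\mathcal A_{\mathcal F_1\cup\mathcal F_2}$ as its system of apartments. That is, it is a nonempty complex and the union of these subcomplexes; each of them is a Coxeter complex (a thin chamber complex such that for any adjacent chambers $C,D$ some folding fixes $C$ and takes $D$ to $C$, a folding being an idempotent simplicial self-map that takes chambers to chambers and for which every chamber in the image is the image of exactly one chamber other than itself); any two simplices lie in a common one of them; and if two of them both contain the simplices $s$ and $t$, there is an isomorphism between them that fixes $s$ and $t$ pointwise. In particular, any two chambers of $\overline{\mathcal A_{\mathcal F_1\cup\mathcal F_2}}$ lie in a common apartment $\mathcal A_{\mathcal F_1\cup\mathcal F_2}$ with $\mathcal F_i$ a frame of $W_i$. -/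

import Mathlib

open scoped Pointwise

/-! ### Chamber complexes, Coxeter complexes, buildings -/

namespace SimplicialBuilding

variable {α : Type*}

/-- The vertex set of a complex. -/
def vertices (K : PreAbstractSimplicialComplex α) : Set α := {v | {v} ∈ K.faces}

/-- A chamber is a maximal simplex. -/
def IsChamber (K : PreAbstractSimplicialComplex α) (C : Finset α) : Prop :=
  Maximal (· ∈ K.faces) C

open Classical in
/-- Two chambers are adjacent if they are distinct and share a face of codimension one. -/
def Adjacent (K : PreAbstractSimplicialComplex α) (C D : Finset α) : Prop :=
  IsChamber K C ∧ IsChamber K D ∧ (C ∩ D).card + 1 = C.card ∧ (C ∩ D).card + 1 = D.card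

/-- A (nonempty, finite-dimensional) chamber complex: every simplex lies in a chamber, all chambers
have the same dimension, and any two chambers are joined by a gallery. -/
structure IsChamberComplex (K : PreAbstractSimplicialComplex α) : Prop where
  nonempty : K.faces.Nonempty
  exists_chamber : ∀ s ∈ K.faces, ∃ C, IsChamber K C ∧ s ⊆ C
  card_eq : ∀ C D, IsChamber K C → IsChamber K D → C.card = D.card
  gallery : ∀ C D, IsChamber K C → IsChamber K D → Relation.ReflTransGen (Adjacent K) C D

open Classical in
/-- Every face of codimension one of a chamber lies in exactly one further chamber. -/
def IsThin (K : PreAbstractSimplicialComplex α) : Prop :=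
  ∀ C, IsChamber K C → ∀ x ∈ C, ∃! D, IsChamber K D ∧ D ≠ C ∧ C.erase x ⊆ D

open Classical in
/-- A folding: an idempotent simplicial endomorphism `φ` taking chambers to chambers, such that each
chamber in the image is the image of exactly one chamber other than itself. (The values of `φ`
outside the vertex set of `K` are irrelevant.) -/
structure IsFolding (K : PreAbstractSimplicialComplex α) (φ : α → α) : Prop where
  map_chamber : ∀ C, IsChamber K C → IsChamber K (C.image φ)
  idem : ∀ v ∈ vertices K, φ (φ v) = φ v
  two_to_one : ∀ C, IsChamber K C → C.image φ = C →
    ∃! D, IsChamber K D ∧ D ≠ C ∧ D.image φ = C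

open Classical in
/-- Coxeter complexes in the sense of Tits: thin chamber complexes such that for every ordered pair
of adjacent chambers `C`, `D` there is a folding that fixes `C` and takes `D` to `C`. -/
structure IsCoxeterComplex (K : PreAbstractSimplicialComplex α) : Prop where
  chamberComplex : IsChamberComplex K
  thin : IsThin K
  exists_folding : ∀ C D, Adjacent K C D →
    ∃ φ, IsFolding K φ ∧ C.image φ = C ∧ D.image φ = C

open Classical in
/-- The vertex map `f` induces an isomorphism of complexes from `K` onto `L`. -/
def IsIso (K L : PreAbstractSimplicialComplex α) (f : α → α) : Prop :=
  Set.BijOn f (vertices K) (vertices L) ∧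
    ∀ s : Finset α, (∀ v ∈ s, v ∈ vertices K) → (s ∈ K.faces ↔ s.image f ∈ L.faces)

/-- `Δ` is a (not necessarily thick) building with system of apartments `𝒜`. -/
structure IsBuilding (Δ : PreAbstractSimplicialComplex α)
    (𝒜 : Set (PreAbstractSimplicialComplex α)) : Prop where
  nonempty : Δ.faces.Nonempty
  eq_union : Δ = sSup 𝒜
  coxeter : ∀ A ∈ 𝒜, IsCoxeterComplex A
  common_apartment : ∀ s ∈ Δ.faces, ∀ t ∈ Δ.faces, ∃ A ∈ 𝒜, s ∈ A.faces ∧ t ∈ A.faces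
  exists_iso : ∀ A ∈ 𝒜, ∀ A' ∈ 𝒜, ∀ s t, s ∈ A.faces → t ∈ A.faces → s ∈ A'.faces → t ∈ A'.faces →
    ∃ f, IsIso A A' f ∧ (∀ v ∈ s, f v = v) ∧ ∀ v ∈ t, f v = v

/-- `Δ'`, with apartments `𝒜'`, is a subbuilding of `Δ`, whose apartments are `𝒜`: it is a
subcomplex, its apartments are apartments of `Δ`, and it is itself a building. -/
structure IsSubbuilding (Δ' : PreAbstractSimplicialComplex α)
    (𝒜' : Set (PreAbstractSimplicialComplex α)) (Δ : PreAbstractSimplicialComplex α)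
    (𝒜 : Set (PreAbstractSimplicialComplex α)) : Prop where
  le : Δ' ≤ Δ
  apartments_subset : 𝒜' ⊆ 𝒜
  isBuilding : IsBuilding Δ' 𝒜'

end SimplicialBuilding

/-! ### The Euclidean building of `GL(V)` through lattices -/

namespace LatticeBuilding

section

variable (O F V : Type*) [CommRing O] [Field F] [Algebra O F] [AddCommGroup V] [Module F V]
  [Module O V] [IsScalarTower O F V]

/-- The `O`-lattices in `V`: finitely generated `O`-submodules spanning `V` over `F`. -/
def Lattice : Type _ := {Λ : Submodule O V // Submodule.IsLattice F Λ}

/-- Homothety of lattices: `Λ' = a Λ` for some `a ∈ Fˣ`. -/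
def homothety : Setoid (Lattice O F V) where
  r Λ Λ' := ∃ a : Fˣ, Λ'.1 = a • Λ.1
  iseqv :=
    { refl := fun Λ => ⟨1, (one_smul _ _).symm⟩
      symm := fun {Λ Λ'} ⟨a, h⟩ => ⟨a⁻¹, by rw [h, inv_smul_smul]⟩
      trans := fun {Λ Λ' Λ''} ⟨a, h⟩ ⟨b, h'⟩ => ⟨b * a, by rw [h', h, mul_smul]⟩ }

/-- The vertices of the building: homothety classes of lattices. -/
def Vertex : Type _ := Quotient (homothety O F V)

variable {O F V}

/-- The homothety class of a lattice. -/
def cls (Λ : Lattice O F V) : Vertex O F V := Quotient.mk (homothety O F V) Λ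

/-- Incidence: there are representatives with `ϖ Λ₁ ⊆ Λ₂ ⊆ Λ₁`. -/
def Incident (ϖ : O) (x y : Vertex O F V) : Prop :=
  ∃ Λ₁ Λ₂ : Lattice O F V, cls Λ₁ = x ∧ cls Λ₂ = y ∧ ϖ • Λ₁.1 ≤ Λ₂.1 ∧ Λ₂.1 ≤ Λ₁.1

variable (F V) in
/-- The complex `B_e GL(V)`: its simplices are the nonempty finite sets of pairwise incident
vertices. -/
def building (ϖ : O) : PreAbstractSimplicialComplex (Vertex O F V) where
  faces := {s | s.Nonempty ∧ ∀ x ∈ s, ∀ y ∈ s, Incident ϖ x y}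
  isRelLowerSet_faces := fun _ hs =>
    ⟨hs.1, fun _ hts ht => ⟨ht, fun x hx y hy => hs.2 x (hts hx) y (hts hy)⟩⟩

/-- A frame of the subspace `W`: an independent set of lines with span `W`. -/
structure IsFrame (W : Submodule F V) (𝓕 : Set (Submodule F V)) : Prop where
  finrank_eq_one : ∀ l ∈ 𝓕, Module.finrank F l = 1
  indep : sSupIndep 𝓕
  sSup_eq : sSup 𝓕 = W

/-- The classes of the lattices `⨁_{l ∈ 𝓕} O e_l` with `0 ≠ e_l ∈ l`. -/
def apartmentVertices (𝓕 : Set (Submodule F V)) : Set (Vertex O F V) :=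
  {x | ∃ Λ : Lattice O F V, cls Λ = x ∧ ∃ e : Submodule F V → V,
    (∀ l ∈ 𝓕, e l ∈ l ∧ e l ≠ 0) ∧ Λ.1 = Submodule.span O (e '' 𝓕)}

/-- The subcomplex `A_𝓕` of `B_e GL(V)`. -/
def apartment (ϖ : O) (𝓕 : Set (Submodule F V)) : PreAbstractSimplicialComplex (Vertex O F V) where
  faces := {s | s ∈ (building F V ϖ).faces ∧ ∀ x ∈ s, x ∈ apartmentVertices 𝓕}
  isRelLowerSet_faces := fun _ hs =>
    ⟨hs.1.1, fun _ hts ht => ⟨((building F V ϖ).isRelLowerSet_faces hs.1).2 hts ht,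
      fun x hx => hs.2 x (hts hx)⟩⟩

variable (F V) in
/-- The apartments of `B_e GL(V)`: the `A_𝓕` for all frames `𝓕` of `V`. -/
def apartments (ϖ : O) : Set (PreAbstractSimplicialComplex (Vertex O F V)) :=
  {A | ∃ 𝓕 : Set (Submodule F V), IsFrame ⊤ 𝓕 ∧ A = apartment ϖ 𝓕}

/-- The apartments `A_{𝓕₁ ∪ 𝓕₂}` for `𝓕₁` a frame of `W₁` and `𝓕₂` a frame of `W₂`. -/
def splitApartments (ϖ : O) (W₁ W₂ : Submodule F V) :
    Set (PreAbstractSimplicialComplex (Vertex O F V)) :=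
  {A | ∃ 𝓕₁ 𝓕₂ : Set (Submodule F V), IsFrame W₁ 𝓕₁ ∧ IsFrame W₂ 𝓕₂ ∧ A = apartment ϖ (𝓕₁ ∪ 𝓕₂)}

/-- The union of the apartments `A_{𝓕₁ ∪ 𝓕₂}` (the supremum of subcomplexes is their union). -/
def splitUnion (ϖ : O) (W₁ W₂ : Submodule F V) : PreAbstractSimplicialComplex (Vertex O F V) :=
  sSup (splitApartments ϖ W₁ W₂)

end

end LatticeBuilding

/-! Apartments. A basis `b` with lines in the frame gives the lattices `⨁ ϖ ^ v l O b l`, so the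
vertices of its apartment are the integer vectors modulo constants, and incidence becomes
`VecIncident` (`isAffineChart_basisVertex`). This is the Coxeter complex of affine type A: the
chambers are the alcoves obtained by raising the coordinates of a vector one after another, and the
foldings reflect in the walls `v a - v b = k` (`IsAffineChart.isCoxeterComplex`).

Isomorphisms. Let `M` be the matrix from `b` to `b'`. Some permutation `σ` satisfies `∑ ord M (σ l)
l ≤ ord det M`. For a lattice with coordinates `v` and `v'` in the two bases, each nonzero entry
gives `v k ≤ v' l + ord M k l`, while `ord det M = ∑ v - ∑ v'`; hence equality holds along `σ`. One
permutation followed by one translation thus carries `v` to `v'` for all common lattices at once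
(`exists_permShift_eq`).

Common apartments. Lattices in a split apartment are the sums of their parts in `W₁` and `W₂`, so it
suffices to find in each summand a frame along which all lattices `Λ i`, `M j` of two given
simplices split. With gauges `a i`, `a' j` measuring divisibility by `ϖ`, choose a nonzero `x` in
the subspace maximizing `∑ (a i x - a' j x)`. A coordinate form `f` with `f x = 1` has `f y • x ∈ M
j` for all `y ∈ M j`; maximality yields the same for the `Λ i` on the subspace, first summed over
`i`, then for each `i`, because gauge differences within a simplex vary by at most one
(`exists_common_splitting_form`). Every lattice now splits off the line of `x`, and induction on
`ker f` gives the frame (`exists_frame_splitsAlong`). -/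

namespace SimplicialBuilding

/-! ### Integer vectors modulo constants, and alcoves -/

variable {α : Type*} {n : ℕ}

/-- Incidence of integer vectors modulo constant vectors. -/
def VecIncident (v w : Fin n → ℤ) : Prop :=
  ∃ m : ℤ, ∀ i, v i ≤ w i + m ∧ w i + m ≤ v i + 1

/-- `P` identifies the vertices of `K` with the integer vectors modulo constant vectors, and the
simplices of `K` with the nonempty finite sets of pairwise incident vectors. -/
structure IsAffineChart (K : PreAbstractSimplicialComplex α) (P : (Fin n → ℤ) → α) : Prop where
  eq_iff : ∀ v w, P v = P w ↔ ∃ m : ℤ, ∀ i, w i = v i + m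
  mem_faces : ∀ s, s ∈ K.faces ↔
    s.Nonempty ∧ (∀ x ∈ s, ∃ v, P v = x) ∧ ∀ v w, P v ∈ s → P w ∈ s → VecIncident v w

/-- The vector `u`, raised by one in the first `c` coordinates with respect to the order `q`. -/
def raise (u : Fin n → ℤ) (q : Equiv.Perm (Fin n)) (c : ℕ) : Fin n → ℤ :=
  fun l => u l + if (q l : ℕ) < c then 1 else 0

theorem raise_zero (u : Fin n → ℤ) (q : Equiv.Perm (Fin n)) : raise u q 0 = u := by
  funext l; simp [raise]

theorem sum_raise (u : Fin n → ℤ) (q : Equiv.Perm (Fin n)) {c : ℕ} (hc : c ≤ n) :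
    ∑ l, raise u q c l = ∑ l, u l + c := by
  simp only [raise, Finset.sum_add_distrib]
  congr 1
  rw [Equiv.sum_comp q (fun l : Fin n => if (l : ℕ) < c then (1 : ℤ) else 0), Finset.sum_boole]
  congr 1
  rw [Fin.card_filter_val_lt]
  simpa using hc

/-- A lower set in `Fin n` is an initial segment. This is how a set of raised coordinates is
recognized as one occurring in `raise`. -/
theorem mem_iff_lt_card_of_isLowerSet {T : Finset (Fin n)} (hT : IsLowerSet (T : Set (Fin n)))
    (i : Fin n) : i ∈ T ↔ (i : ℕ) < T.card := by
  constructor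
  · intro hi
    have : Finset.Iic i ⊆ T := fun j hj => hT (Finset.mem_Iic.1 hj) hi
    have := Finset.card_le_card this
    rw [Fin.card_Iic] at this
    omega
  · intro hi
    by_contra h
    have : T ⊆ Finset.Iio i := fun j hj => by
      rw [Finset.mem_Iio]
      by_contra hij
      exact h (hT (not_lt.1 hij) hj)
    have := Finset.card_le_card this
    rw [Fin.card_Iio] at this
    omega

/-- The reflection in the wall `v a - v b = k`. -/
def reflectVec (a b : Fin n) (k : ℤ) (v : Fin n → ℤ) : Fin n → ℤ :=
  fun l => if l = a then v b + k else if l = b then v a - k else v l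

theorem reflectVec_reflectVec {a b : Fin n} (hab : a ≠ b) (k : ℤ) (v : Fin n → ℤ) :
    reflectVec a b k (reflectVec a b k v) = v := by
  funext l
  simp only [reflectVec]
  grind

theorem reflectVec_eq_self {a b : Fin n} {k : ℤ} {v : Fin n → ℤ} (h : v a - v b = k) :
    reflectVec a b k v = v := by
  funext l
  simp only [reflectVec]
  grind

theorem reflectVec_sub {a b : Fin n} (hab : a ≠ b) (k : ℤ) (v : Fin n → ℤ) :
    reflectVec a b k v a - reflectVec a b k v b = 2 * k - (v a - v b) := by
  simp only [reflectVec]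
  grind

theorem VecIncident.reflectVec {v w : Fin n → ℤ} (h : VecIncident v w) (a b : Fin n) (k : ℤ) :
    VecIncident (reflectVec a b k v) (reflectVec a b k w) := by
  obtain ⟨m, hm⟩ := h
  refine ⟨m, fun i => ?_⟩
  have h1 := hm i
  have h2 := hm a
  have h3 := hm b
  simp only [SimplicialBuilding.reflectVec]
  grind

/-- The constant `m` cancels in differences of coordinates. Walls lie at integer values of `v a - v
b`, so a simplex cannot cross one. -/
theorem VecIncident.sub_le {v w : Fin n → ℤ} (h : VecIncident v w) (a b : Fin n) :
    (v a - v b) - (w a - w b) ≤ 1 := by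
  obtain ⟨m, hm⟩ := h
  have h2 := hm a
  have h3 := hm b
  omega

/-- The map that takes `P v` to `Q v`. -/
noncomputable def chartMap (P Q : (Fin n → ℤ) → α) (x : α) : α :=
  open Classical in if h : ∃ v, P v = x then Q h.choose else x

theorem chartMap_apply {P Q : (Fin n → ℤ) → α} (h : ∀ v w, P v = P w → Q v = Q w)
    (v : Fin n → ℤ) : chartMap P Q (P v) = Q v := by
  have h' : ∃ w, P w = P v := ⟨v, rfl⟩
  rw [chartMap, dif_pos h']
  exact h _ _ h'.choose_spec

/-- The effect of the vector map `g` on the vertices `P v`. -/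
noncomputable def liftMap (P : (Fin n → ℤ) → α) (g : (Fin n → ℤ) → Fin n → ℤ) : α → α :=
  chartMap P fun v => P (g v)

/-- The folding of integer vectors onto the half-space `k ≤ v a - v b`. -/
def foldVec (a b : Fin n) (k : ℤ) (v : Fin n → ℤ) : Fin n → ℤ :=
  if k ≤ v a - v b then v else reflectVec a b k v

theorem le_foldVec_sub {a b : Fin n} (hab : a ≠ b) (k : ℤ) (v : Fin n → ℤ) :
    k ≤ foldVec a b k v a - foldVec a b k v b := by
  rw [foldVec]
  split_ifs with h
  · exact h
  · rw [reflectVec_sub hab]; omega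

theorem foldVec_of_le {a b : Fin n} {k : ℤ} {v : Fin n → ℤ} (h : k ≤ v a - v b) :
    foldVec a b k v = v := if_pos h

theorem foldVec_of_ge {a b : Fin n} {k : ℤ} {v : Fin n → ℤ} (h : v a - v b ≤ k) :
    foldVec a b k v = reflectVec a b k v := by
  rw [foldVec]
  split_ifs with h'
  · rw [reflectVec_eq_self (le_antisymm h h')]
  · rfl

namespace IsAffineChart

variable {K : PreAbstractSimplicialComplex α} {P : (Fin n → ℤ) → α}

theorem sub_eq_of_eq (hP : IsAffineChart K P) {v w : Fin n → ℤ} (h : P v = P w) (a b : Fin n) :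
    w a - w b = v a - v b := by
  obtain ⟨m, hm⟩ := (hP.eq_iff v w).1 h
  rw [hm, hm]; ring

/-- The coordinate sum distinguishes the vertices: a constant `m` changes it by `n * m`, whereas the
sums of the two raised vectors differ by less than `n`, so `m = 0`. -/
theorem raise_eq (hP : IsAffineChart K P) {u : Fin n → ℤ} {q q' : Equiv.Perm (Fin n)} {c c' : ℕ}
    (hc : c < n) (hc' : c' < n) (h : P (raise u q c) = P (raise u q' c')) :
    c = c' ∧ raise u q c = raise u q' c' := by
  obtain ⟨m, hm⟩ := (hP.eq_iff _ _).1 h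
  have hs : ∑ l, raise u q' c' l = ∑ l, raise u q c l + n * m := by
    simp [hm, Finset.sum_add_distrib]
  rw [sum_raise _ _ hc.le, sum_raise _ _ hc'.le] at hs
  have hm0 : m = 0 := by
    have h1 : (n : ℤ) * m < n * 1 := by omega
    have h2 : (n : ℤ) * (-1) < n * m := by omega
    have h3 := lt_of_mul_lt_mul_left h1 (by omega)
    have h4 := lt_of_mul_lt_mul_left h2 (by omega)
    omega
  subst hm0
  refine ⟨by omega, ?_⟩
  funext l
  rw [hm l, add_zero]

open Classical in
/-- The simplex with the vertices `P (raise u q c)` for `c < n`. -/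
noncomputable def alcove (P : (Fin n → ℤ) → α) (u : Fin n → ℤ) (q : Equiv.Perm (Fin n)) :
    Finset α :=
  (Finset.range n).image fun c => P (raise u q c)

theorem mem_alcove {u : Fin n → ℤ} {q : Equiv.Perm (Fin n)} {x : α} :
    x ∈ alcove P u q ↔ ∃ c < n, P (raise u q c) = x := by
  simp [alcove]

theorem base_mem_alcove (hn : 0 < n) (u : Fin n → ℤ) (q : Equiv.Perm (Fin n)) :
    P u ∈ alcove P u q :=
  mem_alcove.2 ⟨0, hn, by rw [raise_zero]⟩

theorem card_alcove (hP : IsAffineChart K P) (u : Fin n → ℤ) (q : Equiv.Perm (Fin n)) :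
    (alcove P u q).card = n := by
  classical
  rw [alcove, Finset.card_image_of_injOn, Finset.card_range]
  intro c hc c' hc' h
  exact (hP.raise_eq (Finset.mem_range.1 hc) (Finset.mem_range.1 hc') h).1

theorem vecIncident_congr (hP : IsAffineChart K P) {v v' w w' : Fin n → ℤ} (hv : P v = P v')
    (hw : P w = P w') (h : VecIncident v w) : VecIncident v' w' := by
  obtain ⟨a, ha⟩ := (hP.eq_iff _ _).1 hv
  obtain ⟨b, hb⟩ := (hP.eq_iff _ _).1 hw
  obtain ⟨m, hm⟩ := h
  refine ⟨m + a - b, fun i => ?_⟩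
  rw [ha, hb]
  have := hm i
  omega

/-- Incidence is independent of representatives, so one incident pair per pair of vertices suffices.
This form passes easily through vertex maps. -/
theorem image_mem_faces_iff (hP : IsAffineChart K P) (s : Finset α) :
    s ∈ K.faces ↔ s.Nonempty ∧ ∀ x ∈ s, ∀ y ∈ s, ∃ v w, P v = x ∧ P w = y ∧ VecIncident v w := by
  rw [hP.mem_faces]
  refine and_congr_right fun _ => ⟨?_, ?_⟩
  · rintro ⟨h1, h2⟩ x hx y hy
    obtain ⟨v, rfl⟩ := h1 x hx
    obtain ⟨w, rfl⟩ := h1 y hy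
    exact ⟨v, w, rfl, rfl, h2 v w hx hy⟩
  · intro h
    refine ⟨fun x hx => ?_, fun v w hv hw => ?_⟩
    · obtain ⟨v, _, hv, _⟩ := h x hx x hx
      exact ⟨v, hv⟩
    · obtain ⟨v', w', h1, h2, h3⟩ := h _ hv _ hw
      exact hP.vecIncident_congr h1 h2 h3

theorem alcove_mem_faces (hP : IsAffineChart K P) (hn : 0 < n) (u : Fin n → ℤ)
    (q : Equiv.Perm (Fin n)) : alcove P u q ∈ K.faces := by
  rw [hP.image_mem_faces_iff]
  refine ⟨⟨_, base_mem_alcove hn u q⟩, fun x hx y hy => ?_⟩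
  obtain ⟨c, hc, rfl⟩ := mem_alcove.1 hx
  obtain ⟨c', hc', rfl⟩ := mem_alcove.1 hy
  refine ⟨_, _, rfl, rfl, ?_⟩
  rcases le_or_gt c c' with h | h
  · refine ⟨0, fun i => ?_⟩
    simp only [raise]
    split_ifs <;> omega
  · refine ⟨1, fun i => ?_⟩
    simp only [raise]
    split_ifs <;> omega

theorem exists_raised_rep (hP : IsAffineChart K P) (hn : 0 < n) {s : Finset α} (hs : s ∈ K.faces)
    {u : Fin n → ℤ} (hu : P u ∈ s) {x : α} (hx : x ∈ s) :
    ∃ v, P v = x ∧ (∀ i, u i ≤ v i ∧ v i ≤ u i + 1) ∧ ∃ i, v i = u i := by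
  obtain ⟨-, h1, h2⟩ := (hP.mem_faces s).1 hs
  obtain ⟨w, rfl⟩ := h1 x hx
  obtain ⟨m, hm⟩ := h2 u w hu hx
  by_cases h : ∃ i, w i + m = u i
  · exact ⟨fun i => w i + m, ((hP.eq_iff _ _).2 ⟨m, fun _ => rfl⟩).symm, hm, h⟩
  · push Not at h
    -- Here `w + m` is `u + 1` in every coordinate, hence in the class of `u`, and `u` itself is the
    -- normalized representative.
    refine ⟨u, (hP.eq_iff _ _).2 ⟨1 - m, fun i => ?_⟩, fun i => ⟨le_rfl, by omega⟩, ⟨0, hn⟩,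
      rfl⟩
    have := hm i
    have := h i
    omega

/-- Relative to `u`, every vertex becomes a proper subset of the coordinates, those raised by one.
Pairwise incidence makes these subsets a chain, and a chain refines to a full flag, that is, to an
ordering of the coordinates. -/
theorem exists_subset_alcove (hP : IsAffineChart K P) (hn : 0 < n) {s : Finset α}
    (hs : s ∈ K.faces) {u : Fin n → ℤ} (hu : P u ∈ s) : ∃ q, s ⊆ alcove P u q := by
  classical
  choose! r hr hru hrz using fun x (hx : x ∈ s) => hP.exists_raised_rep hn hs hu hx
  have hcomp : ∀ x ∈ s, ∀ y ∈ s, (∀ i, r x i ≤ r y i) ∨ ∀ i, r y i ≤ r x i := by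
    intro x hx y hy
    obtain ⟨m, hm⟩ := ((hP.mem_faces s).1 hs).2.2 (r x) (r y) (by rwa [hr x hx]) (by rwa [hr y hy])
    obtain ⟨i, hi⟩ := hrz x hx
    obtain ⟨j, hj⟩ := hrz y hy
    have h1 := hm i
    have h2 := hm j
    have h3 := hru x hx j
    have h4 := hru y hy i
    -- Both representatives touch `u` somewhere, which leaves two values of `m`, one for each
    -- direction of inclusion.
    have : m = 0 ∨ m = 1 := by omega
    rcases this with rfl | rfl
    · exact .inl fun i => by have := hm i; omega
    · exact .inr fun i => by have := hm i; omega
  -- `f l` counts the vertices that do not raise `l`. Sorting by `f` puts the coordinates raised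
  -- most often first, and each set of the chain becomes an initial segment.
  let f : Fin n → ℕ := fun l => (s.filter fun x => r x l = u l).card
  have hf : ∀ x ∈ s, ∀ l k, r x l = u l + 1 → f k ≤ f l → r x k = u k + 1 := by
    intro x hx l k hl hkl
    by_contra hk
    have hk' : r x k = u k := by have := hru x hx k; omega
    refine absurd hkl (not_le.2 (Finset.card_lt_card ?_))
    rw [Finset.ssubset_iff_of_subset]
    · exact ⟨x, Finset.mem_filter.2 ⟨hx, hk'⟩, fun h => by
        have := (Finset.mem_filter.1 h).2; omega⟩
    · intro y hy
      obtain ⟨hys, hyl⟩ := Finset.mem_filter.1 hy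
      refine Finset.mem_filter.2 ⟨hys, ?_⟩
      rcases hcomp x hx y hys with h | h
      · have := h l; omega
      · have := h k; have := hru y hys k; omega
  let σ := Tuple.sort f
  have hσ : Monotone (f ∘ σ) := Tuple.monotone_sort f
  refine ⟨σ.symm, fun x hx => ?_⟩
  let T : Finset (Fin n) := Finset.univ.filter fun i => r x (σ i) = u (σ i) + 1
  have hT : IsLowerSet (T : Set (Fin n)) := by
    intro i j hji hi
    simp only [T, Finset.coe_filter, Finset.mem_univ, true_and, Set.mem_ofPred_eq] at hi ⊢
    exact hf x hx _ _ hi (hσ hji)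
  obtain ⟨i, hi⟩ := hrz x hx
  refine mem_alcove.2 ⟨T.card, ?_, ?_⟩
  · have : σ.symm i ∉ T := by simp [T, hi]
    have h := (mem_iff_lt_card_of_isLowerSet hT _).not.1 this
    have := (σ.symm i).2
    omega
  · rw [← hr x hx]
    congr 1
    funext l
    have h := mem_iff_lt_card_of_isLowerSet hT (σ.symm l)
    simp only [T, Finset.mem_filter, Finset.mem_univ, true_and, Equiv.apply_symm_apply] at h
    rw [raise]
    have := hru x hx l
    split_ifs with h'
    · exact (h.2 h').symm
    · have := h.not.2 h'
      omega

theorem card_le (hP : IsAffineChart K P) (hn : 0 < n) {s : Finset α} (hs : s ∈ K.faces) :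
    s.card ≤ n := by
  obtain ⟨⟨x, hx⟩, h1, -⟩ := (hP.mem_faces s).1 hs
  obtain ⟨u, rfl⟩ := h1 x hx
  obtain ⟨q, hq⟩ := hP.exists_subset_alcove hn hs hx
  exact (Finset.card_le_card hq).trans (hP.card_alcove u q).le

theorem isChamber_of_card_eq (hP : IsAffineChart K P) (hn : 0 < n) {s : Finset α}
    (hs : s ∈ K.faces) (hc : s.card = n) : IsChamber K s :=
  ⟨hs, fun _ ht hst => (Finset.eq_of_subset_of_card_le hst (hc ▸ hP.card_le hn ht)).ge⟩

theorem isChamber_alcove (hP : IsAffineChart K P) (hn : 0 < n) (u : Fin n → ℤ)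
    (q : Equiv.Perm (Fin n)) : IsChamber K (alcove P u q) :=
  hP.isChamber_of_card_eq hn (hP.alcove_mem_faces hn u q) (hP.card_alcove u q)

theorem exists_eq_alcove (hP : IsAffineChart K P) (hn : 0 < n) {C : Finset α} (hC : IsChamber K C)
    {u : Fin n → ℤ} (hu : P u ∈ C) : ∃ q, C = alcove P u q := by
  obtain ⟨q, hq⟩ := hP.exists_subset_alcove hn hC.1 hu
  exact ⟨q, hq.antisymm (hC.2 (hP.alcove_mem_faces hn u q) hq)⟩

theorem exists_vec_mem (hP : IsAffineChart K P) {s : Finset α} (hs : s ∈ K.faces) :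
    ∃ u, P u ∈ s := by
  obtain ⟨⟨x, hx⟩, h1, -⟩ := (hP.mem_faces s).1 hs
  obtain ⟨u, rfl⟩ := h1 x hx
  exact ⟨u, hx⟩

theorem isChamber_card (hP : IsAffineChart K P) (hn : 0 < n) {C : Finset α} (hC : IsChamber K C) :
    C.card = n := by
  obtain ⟨u, hu⟩ := hP.exists_vec_mem hC.1
  obtain ⟨q, rfl⟩ := hP.exists_eq_alcove hn hC hu
  exact hP.card_alcove u q

theorem isChamber_iff (hP : IsAffineChart K P) (hn : 0 < n) {C : Finset α} :
    IsChamber K C ↔ C ∈ K.faces ∧ C.card = n :=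
  ⟨fun h => ⟨h.1, hP.isChamber_card hn h⟩, fun h => hP.isChamber_of_card_eq hn h.1 h.2⟩

theorem exists_chamber (hP : IsAffineChart K P) (hn : 0 < n) {s : Finset α} (hs : s ∈ K.faces) :
    ∃ C, IsChamber K C ∧ s ⊆ C := by
  obtain ⟨u, hu⟩ := hP.exists_vec_mem hs
  obtain ⟨q, hq⟩ := hP.exists_subset_alcove hn hs hu
  exact ⟨_, hP.isChamber_alcove hn u q, hq⟩

/-- Every vertex of a chamber is the second vertex for a suitable enumeration. -/
theorem exists_eq_alcove_raise_one (hP : IsAffineChart K P) (hn : 2 ≤ n) {C : Finset α}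
    (hC : IsChamber K C) {x : α} (hx : x ∈ C) :
    ∃ u q, C = alcove P u q ∧ x = P (raise u q 1) := by
  obtain ⟨w, rfl⟩ := ((hP.mem_faces C).1 hC.1).2.1 x hx
  obtain ⟨q₀, h₀⟩ := hP.exists_eq_alcove (by omega) hC hx
  -- The vertices of an alcove are cyclically ordered. The last one counted from `x` precedes `x`,
  -- so counting from it puts `x` in place 1.
  have hu : P (raise w q₀ (n - 1)) ∈ C := by
    rw [h₀]; exact mem_alcove.2 ⟨n - 1, by omega, rfl⟩
  obtain ⟨q, hq⟩ := hP.exists_eq_alcove (by omega) hC hu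
  refine ⟨_, q, hq, ?_⟩
  rw [hq] at hx
  obtain ⟨c, hc, h⟩ := mem_alcove.1 hx
  suffices c = 1 by rw [← h, this]
  obtain ⟨m, hm⟩ := (hP.eq_iff _ _).1 h
  -- Comparing sums gives `n - 1 + c + n * m = 0` with `0 ≤ c < n`, which forces `m = -1` and `c =
  -- 1`.
  have hs : ∑ l, w l = ∑ l, raise (raise w q₀ (n - 1)) q c l + n * m := by
    simp [hm, Finset.sum_add_distrib]
  rw [sum_raise _ _ hc.le, sum_raise _ _ (by omega)] at hs
  push_cast [show 1 ≤ n by omega] at hs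
  have h1 : (n : ℤ) * m < n * 0 := by omega
  have h2 : (n : ℤ) * (-2) < n * m := by omega
  have h3 := lt_of_mul_lt_mul_left h1 (by omega)
  have h4 := lt_of_mul_lt_mul_left h2 (by omega)
  obtain rfl : m = -1 := by omega
  omega

end IsAffineChart

end SimplicialBuilding

/-! ### Walls, foldings, thinness and galleries -/

namespace SimplicialBuilding

variable {α : Type*} {n : ℕ}

theorem adjacent_of_erase_subset {K : PreAbstractSimplicialComplex α} {C D : Finset α}
    (hC : IsChamber K C) (hD : IsChamber K D) (hcard : C.card = D.card) (hne : D ≠ C) {x : α}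
    (hx : x ∈ C) (h : open Classical in C.erase x ⊆ D) : Adjacent K C D := by
  classical
  have h1 : C ∩ D = C.erase x := by
    refine Finset.Subset.antisymm (fun y hy => ?_) fun y hy =>
      Finset.mem_inter.2 ⟨Finset.mem_of_mem_erase hy, h hy⟩
    obtain ⟨hyC, hyD⟩ := Finset.mem_inter.1 hy
    refine Finset.mem_erase.2 ⟨?_, hyC⟩
    rintro rfl
    refine hne (Finset.eq_of_subset_of_card_le (fun z hz => ?_) hcard.ge).symm
    by_cases hzy : z = y
    · exact hzy ▸ hyD
    · exact h (Finset.mem_erase.2 ⟨hzy, hz⟩)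
  have h2 : (C ∩ D).card + 1 = C.card := by
    rw [h1, Finset.card_erase_add_one hx]
  refine ⟨hC, hD, ?_, ?_⟩
  · convert h2
  · rw [← hcard]; convert h2

theorem Adjacent.exists_erase_subset {K : PreAbstractSimplicialComplex α} {C D : Finset α}
    (h : Adjacent K C D) : ∃ x ∈ C, x ∉ D ∧ open Classical in C.erase x ⊆ D := by
  classical
  obtain ⟨-, -, h1, -⟩ := h
  have h2 : (C \ D).card = 1 := by
    have := Finset.card_sdiff_add_card_inter C D
    have h1' : (C ∩ D).card + 1 = C.card := by convert h1
    omega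
  obtain ⟨x, hx⟩ := Finset.card_eq_one.1 h2
  have hxm : x ∈ C \ D := hx ▸ Finset.mem_singleton_self x
  obtain ⟨hxC, hxD⟩ := Finset.mem_sdiff.1 hxm
  refine ⟨x, hxC, hxD, fun y hy => ?_⟩
  obtain ⟨hyx, hyC⟩ := Finset.mem_erase.1 hy
  by_contra hyD
  exact hyx (Finset.mem_singleton.1 (hx ▸ Finset.mem_sdiff.2 ⟨hyC, hyD⟩))

namespace IsAffineChart

variable {K : PreAbstractSimplicialComplex α} {P : (Fin n → ℤ) → α}

theorem reflectVec_congr (hP : IsAffineChart K P) (a b : Fin n) (k : ℤ) (v w : Fin n → ℤ)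
    (h : P v = P w) : P (reflectVec a b k v) = P (reflectVec a b k w) := by
  obtain ⟨m, hm⟩ := (hP.eq_iff v w).1 h
  refine (hP.eq_iff _ _).2 ⟨m, fun i => ?_⟩
  simp only [reflectVec, hm]
  split_ifs <;> ring

theorem foldVec_congr (hP : IsAffineChart K P) (a b : Fin n) (k : ℤ) (v w : Fin n → ℤ)
    (h : P v = P w) : P (foldVec a b k v) = P (foldVec a b k w) := by
  rw [foldVec, foldVec, hP.sub_eq_of_eq h a b]
  split_ifs
  · exact h
  · exact hP.reflectVec_congr a b k v w h

theorem reflect_apply (hP : IsAffineChart K P) (a b : Fin n) (k : ℤ) (v : Fin n → ℤ) :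
    liftMap P (reflectVec a b k) (P v) = P (reflectVec a b k v) :=
  chartMap_apply (hP.reflectVec_congr a b k) v

theorem fold_apply (hP : IsAffineChart K P) (a b : Fin n) (k : ℤ) (v : Fin n → ℤ) :
    liftMap P (foldVec a b k) (P v) = P (foldVec a b k v) :=
  chartMap_apply (hP.foldVec_congr a b k) v

theorem exists_vec (hP : IsAffineChart K P) {s : Finset α} (hs : s ∈ K.faces) {x : α}
    (hx : x ∈ s) : ∃ v, P v = x := ((hP.mem_faces s).1 hs).2.1 x hx

open Classical in
theorem image_reflect_reflect (hP : IsAffineChart K P) {a b : Fin n} (hab : a ≠ b) (k : ℤ)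
    {s : Finset α} (hs : s ∈ K.faces) :
    (s.image (liftMap P (reflectVec a b k))).image (liftMap P (reflectVec a b k)) = s := by
  rw [Finset.image_image]
  conv_rhs => rw [← Finset.image_id (s := s)]
  refine Finset.image_congr fun x hx => ?_
  obtain ⟨v, rfl⟩ := hP.exists_vec hs hx
  simp only [Function.comp_apply, hP.reflect_apply, reflectVec_reflectVec hab, id]

open Classical in
theorem isChamber_image_reflect (hP : IsAffineChart K P) (hn : 0 < n) {a b : Fin n} (hab : a ≠ b)
    (k : ℤ) {C : Finset α} (hC : IsChamber K C) :
    IsChamber K (C.image (liftMap P (reflectVec a b k))) := by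
  rw [hP.isChamber_iff hn] at hC ⊢
  constructor
  · rw [hP.image_mem_faces_iff]
    refine ⟨((hP.mem_faces C).1 hC.1).1.image _, fun x hx y hy => ?_⟩
    obtain ⟨x, hxC, rfl⟩ := Finset.mem_image.1 hx
    obtain ⟨y, hyC, rfl⟩ := Finset.mem_image.1 hy
    obtain ⟨v, w, rfl, rfl, h⟩ := ((hP.image_mem_faces_iff C).1 hC.1).2 x hxC y hyC
    exact ⟨_, _, (hP.reflect_apply a b k v).symm, (hP.reflect_apply a b k w).symm,
      h.reflectVec a b k⟩
  · refine le_antisymm (Finset.card_image_le.trans hC.2.le) ?_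
    calc n = ((C.image (liftMap P (reflectVec a b k))).image
          (liftMap P (reflectVec a b k))).card := by rw [hP.image_reflect_reflect hab k hC.1, hC.2]
      _ ≤ _ := Finset.card_image_le

theorem le_or_ge_of_mem_faces (hP : IsAffineChart K P) {s : Finset α} (hs : s ∈ K.faces)
    (a b : Fin n) (k : ℤ) :
    (∀ v, P v ∈ s → k ≤ v a - v b) ∨ ∀ v, P v ∈ s → v a - v b ≤ k := by
  by_contra! h
  obtain ⟨⟨v, hv, hvk⟩, w, hw, hwk⟩ := h
  have := (((hP.mem_faces s).1 hs).2.2 w v hw hv).sub_le a b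
  omega

open Classical in
theorem image_fold_of_le (hP : IsAffineChart K P) {s : Finset α} (hs : s ∈ K.faces) {a b : Fin n}
    {k : ℤ} (h : ∀ v, P v ∈ s → k ≤ v a - v b) : s.image (liftMap P (foldVec a b k)) = s := by
  conv_rhs => rw [← Finset.image_id (s := s)]
  refine Finset.image_congr fun x hx => ?_
  obtain ⟨v, rfl⟩ := hP.exists_vec hs hx
  rw [hP.fold_apply, foldVec_of_le (h v hx), id]

open Classical in
theorem image_fold_of_ge (hP : IsAffineChart K P) {s : Finset α} (hs : s ∈ K.faces) {a b : Fin n}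
    {k : ℤ} (h : ∀ v, P v ∈ s → v a - v b ≤ k) :
    s.image (liftMap P (foldVec a b k)) = s.image (liftMap P (reflectVec a b k)) := by
  refine Finset.image_congr fun x hx => ?_
  obtain ⟨v, rfl⟩ := hP.exists_vec hs hx
  rw [hP.fold_apply, hP.reflect_apply, foldVec_of_ge (h v hx)]

open Classical in
theorem ge_of_mem_image_reflect (hP : IsAffineChart K P) {s : Finset α} (hs : s ∈ K.faces)
    {a b : Fin n} (hab : a ≠ b) {k : ℤ} (h : ∀ v, P v ∈ s → k ≤ v a - v b) (v : Fin n → ℤ)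
    (hv : P v ∈ s.image (liftMap P (reflectVec a b k))) : v a - v b ≤ k := by
  obtain ⟨x, hx, hxv⟩ := Finset.mem_image.1 hv
  obtain ⟨w, rfl⟩ := hP.exists_vec hs hx
  rw [hP.reflect_apply] at hxv
  rw [hP.sub_eq_of_eq hxv a b, reflectVec_sub hab]
  have := h w hx
  omega

/-- No chamber lies in a wall: just after the earlier of `a` and `b` is raised, the difference of
these coordinates has changed from its value at `u`. -/
theorem exists_sub_ne (hP : IsAffineChart K P) {C : Finset α} (hC : IsChamber K C)
    {a b : Fin n} (hab : a ≠ b) (k : ℤ) : ∃ v, P v ∈ C ∧ v a - v b ≠ k := by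
  have hn : 0 < n := a.pos
  obtain ⟨u, hu⟩ := hP.exists_vec_mem hC.1
  obtain ⟨q, rfl⟩ := hP.exists_eq_alcove hn hC hu
  by_contra! h
  have hqab : (q a : ℕ) ≠ q b := fun e => hab (q.injective (Fin.ext e))
  have h0 := h u hu
  have h1 := h _ (mem_alcove.2 ⟨min (q a : ℕ) (q b : ℕ) + 1,
    by have := (q a).2; have := (q b).2; omega, rfl⟩)
  simp only [raise] at h1
  split_ifs at h1 <;> omega

/-- Each chamber lies on one side of the wall, so the fold is the identity or the reflection on it.
The second preimage of a fixed chamber is its mirror image, which is distinct since no chamber lies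
in the wall. -/
theorem isFolding_fold (hP : IsAffineChart K P) {a b : Fin n} (hab : a ≠ b) (k : ℤ) :
    IsFolding K (liftMap P (foldVec a b k)) := by
  classical
  have hn : 0 < n := a.pos
  refine ⟨fun C hC => ?_, fun x hx => ?_, fun C hC hfix => ?_⟩
  · rcases hP.le_or_ge_of_mem_faces hC.1 a b k with h | h
    · rwa [hP.image_fold_of_le hC.1 h]
    · rw [hP.image_fold_of_ge hC.1 h]
      exact hP.isChamber_image_reflect hn hab k hC
  · obtain ⟨v, rfl⟩ := hP.exists_vec hx (Finset.mem_singleton_self x)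
    rw [hP.fold_apply, hP.fold_apply, foldVec_of_le (le_foldVec_sub hab k v)]
  · have hle : ∀ v, P v ∈ C → k ≤ v a - v b := by
      intro v hv
      rw [← hfix] at hv
      obtain ⟨x, hx, hxv⟩ := Finset.mem_image.1 hv
      obtain ⟨w, rfl⟩ := hP.exists_vec hC.1 hx
      rw [hP.fold_apply] at hxv
      rw [hP.sub_eq_of_eq hxv a b]
      exact le_foldVec_sub hab k w
    have hD := hP.isChamber_image_reflect hn hab k hC
    have hDle := hP.ge_of_mem_image_reflect hC.1 hab hle
    refine ⟨C.image (liftMap P (reflectVec a b k)), ⟨hD, ?_, ?_⟩, ?_⟩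
    · intro h
      obtain ⟨v, hv, hvk⟩ := hP.exists_sub_ne hC hab k
      have h1 := hle v hv
      have h2 := hDle v (h.symm ▸ hv)
      omega
    · rw [hP.image_fold_of_ge hD.1 hDle, hP.image_reflect_reflect hab k hC.1]
    · rintro D ⟨hD', hne, himg⟩
      rcases hP.le_or_ge_of_mem_faces hD'.1 a b k with h | h
      · rw [hP.image_fold_of_le hD'.1 h] at himg
        exact absurd himg hne
      · rw [hP.image_fold_of_ge hD'.1 h] at himg
        rw [← himg, hP.image_reflect_reflect hab k hD'.1]

open Classical in
/-- The wall between a chamber and its neighbour opposite to one of its vertices. -/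
theorem exists_wall (hP : IsAffineChart K P) (hn : 2 ≤ n) {C : Finset α} (hC : IsChamber K C)
    {x : α} (hx : x ∈ C) : ∃ (a b : Fin n) (k : ℤ), a ≠ b ∧
      (∀ v, P v ∈ C → P v ≠ x → v a - v b = k) ∧ (∀ v, P v = x → v a - v b = k + 1) ∧
      ∀ D, IsChamber K D → C.erase x ⊆ D →
        D = C ∨ D = C.image (liftMap P (reflectVec a b k)) := by
  obtain ⟨u, q, rfl, rfl⟩ := hP.exists_eq_alcove_raise_one hn hC hx
  -- With `x` in place 1, `a` is raised first and `b` second. Only at `x` is exactly one of them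
  -- raised, so all other vertices lie on the wall.
  set a := q.symm ⟨0, by omega⟩ with ha
  set b := q.symm ⟨1, by omega⟩ with hb
  have hqa : (q a : ℕ) = 0 := by simp [ha]
  have hqb : (q b : ℕ) = 1 := by simp [hb]
  have hab : a ≠ b := fun h => by rw [h] at hqa; omega
  have hq0 : ∀ l, (q l : ℕ) = 0 → l = a := fun l hl => q.injective (Fin.ext (by omega))
  have hq1 : ∀ l, (q l : ℕ) = 1 → l = b := fun l hl => q.injective (Fin.ext (by omega))
  refine ⟨a, b, u a - u b, hab, fun v hv hvx => ?_, fun v hv => ?_, fun D hD hsub => ?_⟩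
  · obtain ⟨c, hc, h⟩ := mem_alcove.1 hv
    have hc1 : c ≠ 1 := by rintro rfl; exact hvx h.symm
    rw [hP.sub_eq_of_eq h]
    simp only [raise, hqa, hqb]
    split_ifs <;> omega
  · rw [hP.sub_eq_of_eq hv.symm]
    simp only [raise, hqa, hqb]
    norm_num
    ring
  · have hmem : ∀ c < n, c ≠ 1 → P (raise u q c) ∈ D := fun c hc hc1 =>
      hsub (Finset.mem_erase.2 ⟨fun h => hc1 (hP.raise_eq hc (by omega) h).1,
        mem_alcove.2 ⟨c, hc, rfl⟩⟩)
    have huD : P u ∈ D := by simpa [raise_zero] using hmem 0 (by omega) (by omega)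
    obtain ⟨q', rfl⟩ := hP.exists_eq_alcove (by omega) hD huD
    have hraise : ∀ c < n, c ≠ 1 → raise u q c = raise u q' c := by
      intro c hc hc1
      obtain ⟨c', hc', h⟩ := mem_alcove.1 (hmem c hc hc1)
      obtain ⟨rfl, h'⟩ := hP.raise_eq hc' hc h
      exact h'.symm
    have h2 : ∀ l, (q' l : ℕ) < 2 → (q l : ℕ) < 2 := by
      intro l hl
      rcases hn.eq_or_lt with h | h
      · have := (q l).2; omega
      · have := congrFun (hraise 2 h (by omega)) l
        simp only [raise, hl, if_true] at this
        by_contra h'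
        simp [h'] at this
    set l₀ := q'.symm ⟨0, by omega⟩ with hl₀
    have hql₀ : (q' l₀ : ℕ) = 0 := by simp [hl₀]
    have hq'0 : ∀ l, (q' l : ℕ) = 0 → l = l₀ := fun l hl => q'.injective (Fin.ext (by omega))
    have hcase : l₀ = a ∨ l₀ = b := by
      have := h2 l₀ (by omega)
      have : (q l₀ : ℕ) = 0 ∨ (q l₀ : ℕ) = 1 := by omega
      exact this.imp (hq0 _) (hq1 _)
    -- A chamber on this panel also raises `a` and `b` in its first two steps. Starting with `a`
    -- gives `C`; starting with `b` gives the mirror image.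
    rcases hcase with h | h
    · left
      refine Finset.image_congr fun c hc => ?_
      have hc := Finset.mem_range.1 hc
      by_cases hc1 : c = 1
      · subst hc1
        suffices raise u q 1 = raise u q' 1 by simp only [this]
        funext l
        have e : (q l : ℕ) < 1 ↔ (q' l : ℕ) < 1 := by
          constructor
          · intro hl; rw [hq0 l (by omega), ← h]; omega
          · intro hl; rw [hq'0 l (by omega), h]; omega
        simp only [raise, e]
      · simp only [hraise c hc hc1]
    · right
      rw [alcove, alcove, Finset.image_image]
      refine Finset.image_congr fun c hc => ?_
      have hc := Finset.mem_range.1 hc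
      simp only [Function.comp_apply, hP.reflect_apply]
      congr 1
      by_cases hc1 : c = 1
      · subst hc1
        funext l
        have e : (q' l : ℕ) < 1 ↔ l = b := by
          constructor
          · intro hl; rw [hq'0 l (by omega), h]
          · rintro rfl; rw [← h]; omega
        have e' : (q l : ℕ) < 1 ↔ l = a := by
          constructor
          · intro hl; exact hq0 l (by omega)
          · rintro rfl; omega
        simp only [raise, reflectVec, e, e']
        grind
      · rw [← hraise c hc hc1, reflectVec_eq_self]
        simp only [raise, hqa, hqb]
        split_ifs <;> omega

theorem isThin (hP : IsAffineChart K P) (hn : 2 ≤ n) : IsThin K := by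
  classical
  intro C hC x hx
  obtain ⟨a, b, k, hab, h1, h2, h3⟩ := hP.exists_wall hn hC hx
  refine ⟨C.image (liftMap P (reflectVec a b k)),
    ⟨hP.isChamber_image_reflect (by omega) hab k hC, fun h => ?_, fun y hy => ?_⟩, ?_⟩
  · obtain ⟨v, rfl⟩ := hP.exists_vec hC.1 hx
    have hle : ∀ w, P w ∈ C → k ≤ w a - w b := by
      intro w hw
      by_cases hwv : P w = P v
      · have := h2 w hwv; omega
      · exact (h1 w hw hwv).ge
    have h4 := hP.ge_of_mem_image_reflect hC.1 hab hle v (h.symm ▸ hx)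
    have := h2 v rfl
    omega
  · obtain ⟨hyx, hyC⟩ := Finset.mem_erase.1 hy
    obtain ⟨v, rfl⟩ := hP.exists_vec hC.1 hyC
    refine Finset.mem_image.2 ⟨P v, hyC, ?_⟩
    rw [hP.reflect_apply, reflectVec_eq_self (h1 v hyC hyx)]
  · rintro D ⟨hD, hne, hsub⟩
    exact (h3 D hD hsub).resolve_left hne

theorem exists_folding (hP : IsAffineChart K P) (hn : 2 ≤ n) {C D : Finset α}
    (h : Adjacent K C D) :
    open Classical in ∃ φ, IsFolding K φ ∧ C.image φ = C ∧ D.image φ = C := by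
  classical
  obtain ⟨x, hxC, hxD, hsub⟩ := h.exists_erase_subset
  obtain ⟨hC, hD, -⟩ := h
  obtain ⟨a, b, k, hab, h1, h2, h3⟩ := hP.exists_wall hn hC hxC
  have hle : ∀ w, P w ∈ C → k ≤ w a - w b := by
    intro w hw
    by_cases hwv : P w = x
    · have := h2 w hwv; omega
    · exact (h1 w hw hwv).ge
  have hDC : D = C.image (liftMap P (reflectVec a b k)) :=
    (h3 D hD hsub).resolve_left fun e => hxD (e ▸ hxC)
  refine ⟨_, hP.isFolding_fold hab k, hP.image_fold_of_le hC.1 hle, ?_⟩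
  subst hDC
  rw [hP.image_fold_of_ge hD.1 (hP.ge_of_mem_image_reflect hC.1 hab hle),
    hP.image_reflect_reflect hab k hC.1]

/-- Exchanging two consecutive places affects only the vertex at which exactly one of the two
coordinates is raised. -/
theorem reflTransGen_alcove_swap (hP : IsAffineChart K P) (u : Fin n → ℤ)
    (q : Equiv.Perm (Fin n)) {i j : Fin n} (hij : (j : ℕ) = i + 1) :
    Relation.ReflTransGen (Adjacent K) (alcove P u q) (alcove P u (Equiv.swap i j * q)) := by
  classical
  have hn : 0 < n := i.pos
  by_cases h : alcove P u (Equiv.swap i j * q) = alcove P u q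
  · rw [h]
  refine .single (adjacent_of_erase_subset (hP.isChamber_alcove hn u q)
    (hP.isChamber_alcove hn u _) (by rw [hP.card_alcove, hP.card_alcove]) h
    (x := P (raise u q j)) (mem_alcove.2 ⟨j, j.2, rfl⟩) fun y hy => ?_)
  obtain ⟨hne, hy⟩ := Finset.mem_erase.1 hy
  obtain ⟨c, hc, rfl⟩ := mem_alcove.1 hy
  have hcj : c ≠ j := by rintro rfl; exact hne rfl
  refine mem_alcove.2 ⟨c, hc, ?_⟩
  congr 1
  funext l
  simp only [raise, Equiv.Perm.mul_apply, Equiv.swap_apply_def]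
  have e1 : q l = i ↔ (q l : ℕ) = i := Fin.ext_iff
  have e2 : q l = j ↔ (q l : ℕ) = j := Fin.ext_iff
  split_ifs <;> grind

/-- The alcoves around `P u` are connected because adjacent transpositions generate the symmetric
group. -/
theorem reflTransGen_alcove_perm (hP : IsAffineChart K P) (u : Fin n → ℤ)
    (q q' : Equiv.Perm (Fin n)) :
    Relation.ReflTransGen (Adjacent K) (alcove P u q) (alcove P u q') := by
  obtain rfl | ⟨m, rfl⟩ : n = 0 ∨ ∃ m, n = m + 1 := by
    cases n with
    | zero => exact .inl rfl
    | succ m => exact .inr ⟨m, rfl⟩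
  · rw [Subsingleton.elim q q']
  have key : ∀ g : Equiv.Perm (Fin (m + 1)), ∀ q,
      Relation.ReflTransGen (Adjacent K) (alcove P u q) (alcove P u (g * q)) := by
    intro g
    have hg : g ∈ Submonoid.closure
        (Set.range fun i : Fin m => Equiv.swap i.castSucc i.succ) := by
      rw [Equiv.Perm.mclosure_swap_castSucc_succ]; trivial
    induction hg using Submonoid.closure_induction with
    | mem g hg =>
      obtain ⟨i, rfl⟩ := hg
      intro q
      exact hP.reflTransGen_alcove_swap u q (by simp)
    | one => intro q; rw [one_mul]
    | mul g h _ _ ihg ihh =>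
      intro q
      rw [mul_assoc]
      exact (ihh q).trans (ihg _)
  simpa using key (q' * q⁻¹) q

/-- An alcove that raises `a` first contains both base vertices and can be enumerated from either.
Both directions are recorded because induction over the integers also steps downwards. -/
theorem reflTransGen_alcove_add_single (hP : IsAffineChart K P) (hn : 2 ≤ n) (u : Fin n → ℤ)
    (a : Fin n) (q q' : Equiv.Perm (Fin n)) :
    Relation.ReflTransGen (Adjacent K) (alcove P u q) (alcove P (u + Pi.single a 1) q') ∧
    Relation.ReflTransGen (Adjacent K) (alcove P (u + Pi.single a 1) q') (alcove P u q) := by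
  let p : Equiv.Perm (Fin n) := Equiv.swap a ⟨0, by omega⟩
  have hr : raise u p 1 = u + Pi.single a 1 := by
    funext l
    have : ((p l : Fin n) : ℕ) < 1 ↔ l = a := by
      rw [Nat.lt_one_iff, show (0 : ℕ) = ((⟨0, by omega⟩ : Fin n) : ℕ) from rfl, ← Fin.ext_iff]
      simp only [p]
      conv_lhs => rhs; rw [← Equiv.swap_apply_left a ⟨0, by omega⟩]
      exact (Equiv.swap a _).injective.eq_iff
    simp [raise, this, Pi.single_apply]
  have hmem : P (u + Pi.single a 1) ∈ alcove P u p := mem_alcove.2 ⟨1, by omega, by rw [hr]⟩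
  obtain ⟨p', hp'⟩ := hP.exists_eq_alcove (by omega) (hP.isChamber_alcove (by omega) u p) hmem
  constructor
  · refine (hP.reflTransGen_alcove_perm u q p).trans ?_
    rw [hp']
    exact hP.reflTransGen_alcove_perm _ p' q'
  · refine (hP.reflTransGen_alcove_perm _ q' p').trans ?_
    rw [← hp']
    exact hP.reflTransGen_alcove_perm _ p q

theorem reflTransGen_alcove (hP : IsAffineChart K P) (hn : 2 ≤ n) (u w : Fin n → ℤ)
    (q q' : Equiv.Perm (Fin n)) :
    Relation.ReflTransGen (Adjacent K) (alcove P u q) (alcove P w q') := by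
  have h1 : ∀ (a : Fin n) (m : ℤ) (u : Fin n → ℤ),
      Relation.ReflTransGen (Adjacent K) (alcove P u 1) (alcove P (u + Pi.single a m) 1) := by
    intro a m
    induction m using Int.induction_on with
    | zero => intro u; simp only [Pi.single_zero, add_zero]; exact .refl
    | succ i ih =>
      intro u
      rw [Pi.single_add, ← add_assoc]
      exact (ih u).trans (hP.reflTransGen_alcove_add_single hn _ a 1 1).1
    | pred i ih =>
      intro u
      refine (ih u).trans ?_
      have := (hP.reflTransGen_alcove_add_single hn (u + Pi.single a (-(i : ℤ) - 1)) a 1 1).2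
      rwa [add_assoc, ← Pi.single_add, sub_add_cancel] at this
  have h2 : ∀ (s : Finset (Fin n)) (d u : Fin n → ℤ),
      Relation.ReflTransGen (Adjacent K) (alcove P u 1)
        (alcove P (u + ∑ a ∈ s, Pi.single a (d a)) 1) := by
    intro s d
    induction s using Finset.induction_on with
    | empty => intro u; simp only [Finset.sum_empty, add_zero]; exact .refl
    | insert a s ha ih =>
      intro u
      rw [Finset.sum_insert ha, ← add_assoc]
      exact (h1 a _ u).trans (ih _)
  have h3 := h2 Finset.univ (w - u) u
  rw [Finset.univ_sum_single, add_sub_cancel] at h3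
  exact ((hP.reflTransGen_alcove_perm u q 1).trans h3).trans (hP.reflTransGen_alcove_perm w 1 q')

theorem isCoxeterComplex (hP : IsAffineChart K P) (hn : 2 ≤ n) : IsCoxeterComplex K where
  chamberComplex :=
    { nonempty := ⟨_, hP.alcove_mem_faces (by omega) 0 1⟩
      exists_chamber := fun _ hs => hP.exists_chamber (by omega) hs
      card_eq := fun C D hC hD => by
        rw [hP.isChamber_card (by omega) hC, hP.isChamber_card (by omega) hD]
      gallery := fun C D hC hD => by
        obtain ⟨u, hu⟩ := hP.exists_vec_mem hC.1
        obtain ⟨q, rfl⟩ := hP.exists_eq_alcove (by omega) hC hu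
        obtain ⟨w, hw⟩ := hP.exists_vec_mem hD.1
        obtain ⟨q', rfl⟩ := hP.exists_eq_alcove (by omega) hD hw
        exact hP.reflTransGen_alcove hn u w q q' }
  thin := hP.isThin hn
  exists_folding := fun _ _ h => hP.exists_folding hn h

end IsAffineChart

end SimplicialBuilding

/-! ### Isomorphisms by permutation and translation of coordinates -/

namespace SimplicialBuilding

variable {α : Type*} {n : ℕ}

/-- Permute the coordinates and translate. -/
def permShift (σ : Equiv.Perm (Fin n)) (c v : Fin n → ℤ) : Fin n → ℤ :=
  fun l => v (σ l) - c l

theorem vecIncident_permShift_iff (σ : Equiv.Perm (Fin n)) (c : Fin n → ℤ) {v w : Fin n → ℤ} :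
    VecIncident (permShift σ c v) (permShift σ c w) ↔ VecIncident v w := by
  refine exists_congr fun m => ?_
  rw [← σ.forall_congr_right (q := fun i => v i ≤ w i + m ∧ w i + m ≤ v i + 1)]
  refine forall_congr' fun i => ?_
  simp only [permShift]
  constructor <;> intro h <;> omega

theorem permShift_surjective (σ : Equiv.Perm (Fin n)) (c : Fin n → ℤ) :
    Function.Surjective (permShift σ c) := fun w =>
  ⟨fun k => w (σ.symm k) + c (σ.symm k), by funext l; simp [permShift]⟩

namespace IsAffineChart

variable {K K' : PreAbstractSimplicialComplex α} {P P' : (Fin n → ℤ) → α}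

theorem mem_vertices_iff (hP : IsAffineChart K P) {x : α} : x ∈ vertices K ↔ ∃ v, P v = x := by
  refine ⟨fun h => ((hP.mem_faces _).1 h).2.1 x (Finset.mem_singleton_self x), ?_⟩
  rintro ⟨v, rfl⟩
  refine (hP.image_mem_faces_iff _).2 ⟨Finset.singleton_nonempty _, fun x hx y hy => ?_⟩
  rw [Finset.mem_singleton] at hx hy
  exact ⟨v, v, hx.symm, hy.symm, 0, fun i => by omega⟩

theorem permShift_eq_iff (hP : IsAffineChart K P) (hP' : IsAffineChart K' P')
    (σ : Equiv.Perm (Fin n)) (c : Fin n → ℤ) (v w : Fin n → ℤ) :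
    P' (permShift σ c v) = P' (permShift σ c w) ↔ P v = P w := by
  rw [hP.eq_iff, hP'.eq_iff]
  refine exists_congr fun m => ?_
  rw [← σ.forall_congr_right (q := fun i => w i = v i + m)]
  refine forall_congr' fun i => ?_
  simp only [permShift]
  constructor <;> intro h <;> omega

theorem chartMap_permShift_apply (hP : IsAffineChart K P) (hP' : IsAffineChart K' P')
    (σ : Equiv.Perm (Fin n)) (c v : Fin n → ℤ) :
    chartMap P (fun v => P' (permShift σ c v)) (P v) = P' (permShift σ c v) :=
  chartMap_apply (fun v w h => (hP.permShift_eq_iff hP' σ c v w).2 h) v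

theorem isIso_permShift (hP : IsAffineChart K P) (hP' : IsAffineChart K' P')
    (σ : Equiv.Perm (Fin n)) (c : Fin n → ℤ) :
    IsIso K K' (chartMap P fun v => P' (permShift σ c v)) := by
  classical
  refine ⟨⟨fun x hx => ?_, fun x hx y hy h => ?_, fun y hy => ?_⟩, fun s hs => ?_⟩
  · obtain ⟨v, rfl⟩ := hP.mem_vertices_iff.1 hx
    rw [hP.chartMap_permShift_apply hP']
    exact hP'.mem_vertices_iff.2 ⟨_, rfl⟩
  · obtain ⟨v, rfl⟩ := hP.mem_vertices_iff.1 hx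
    obtain ⟨w, rfl⟩ := hP.mem_vertices_iff.1 hy
    rw [hP.chartMap_permShift_apply hP', hP.chartMap_permShift_apply hP'] at h
    exact (hP.permShift_eq_iff hP' σ c v w).1 h
  · obtain ⟨w, rfl⟩ := hP'.mem_vertices_iff.1 hy
    obtain ⟨v, rfl⟩ := permShift_surjective σ c w
    exact ⟨P v, hP.mem_vertices_iff.2 ⟨v, rfl⟩, hP.chartMap_permShift_apply hP' σ c v⟩
  · rw [hP.image_mem_faces_iff, hP'.image_mem_faces_iff, Finset.image_nonempty]
    refine and_congr_right fun _ => ?_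
    simp only [Finset.forall_mem_image]
    refine forall₂_congr fun x hx => forall₂_congr fun y hy => ?_
    obtain ⟨v, rfl⟩ := hP.mem_vertices_iff.1 (hs x hx)
    obtain ⟨w, rfl⟩ := hP.mem_vertices_iff.1 (hs y hy)
    rw [hP.chartMap_permShift_apply hP', hP.chartMap_permShift_apply hP']
    constructor
    · rintro ⟨v', w', h1, h2, h⟩
      exact ⟨_, _, rfl, rfl, (vecIncident_permShift_iff σ c).2 (hP.vecIncident_congr h1 h2 h)⟩
    · rintro ⟨v', w', h1, h2, h⟩
      exact ⟨v, w, rfl, rfl, (vecIncident_permShift_iff σ c).1 (hP'.vecIncident_congr h1 h2 h)⟩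

end IsAffineChart

end SimplicialBuilding

/-! ### The valuation on the fraction field -/

namespace LatticeBuilding

section Order

variable {O F : Type*} [CommRing O] [Field F] [Algebra O F]

/-- The normalized valuation of a nonzero element of `F` with respect to the uniformizer `ϖ`. -/
noncomputable def ord (ϖ : O) (c : F) : ℤ :=
  open Classical in
  if h : ∃ m : ℤ, ∃ u : Oˣ, c = algebraMap O F u * algebraMap O F ϖ ^ m then h.choose else 0

variable [IsFractionRing O F] {ϖ : O}

theorem algebraMap_uniformizer_ne_zero (hϖ : Irreducible ϖ) : algebraMap O F ϖ ≠ 0 := by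
  simpa using hϖ.ne_zero

theorem zpow_uniformizer_ne_zero (hϖ : Irreducible ϖ) (m : ℤ) : algebraMap O F ϖ ^ m ≠ 0 :=
  zpow_ne_zero m (algebraMap_uniformizer_ne_zero hϖ)

theorem exists_algebraMap_eq_unit_mul_zpow_iff (hϖ : Irreducible ϖ) (u : Oˣ) (m : ℤ) :
    (∃ o : O, algebraMap O F o = algebraMap O F u * algebraMap O F ϖ ^ m) ↔ 0 ≤ m := by
  constructor
  · rintro ⟨o, ho⟩
    by_contra! hm
    obtain ⟨k, rfl⟩ : ∃ k : ℕ, m = -(k + 1 : ℕ) := ⟨(-m - 1).toNat, by omega⟩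
    rw [zpow_neg, zpow_natCast, ← div_eq_mul_inv,
      eq_div_iff (pow_ne_zero _ (algebraMap_uniformizer_ne_zero hϖ)), ← map_pow, ← map_mul] at ho
    have h : o * ϖ ^ (k + 1) = u := IsFractionRing.injective O F ho
    refine hϖ.not_isUnit (isUnit_of_dvd_unit ?_ u.isUnit)
    exact ⟨o * ϖ ^ k, by rw [← h]; ring⟩
  · intro hm
    lift m to ℕ using hm
    exact ⟨u * ϖ ^ m, by simp⟩

variable [IsDomain O] [IsDiscreteValuationRing O]

theorem exists_unit_mul_zpow_ord (hϖ : Irreducible ϖ) {c : F} (hc : c ≠ 0) :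
    ∃ u : Oˣ, c = algebraMap O F u * algebraMap O F ϖ ^ ord ϖ c := by
  have h : ∃ m : ℤ, ∃ u : Oˣ, c = algebraMap O F u * algebraMap O F ϖ ^ m := by
    obtain ⟨m, u, h⟩ :=
      IsDiscreteValuationRing.exists_units_eq_smul_zpow_of_irreducible hϖ hc
    exact ⟨m, u, by rw [h, Units.smul_def, Algebra.smul_def]⟩
  rw [ord, dif_pos h]
  exact h.choose_spec

theorem exists_algebraMap_eq_iff (hϖ : Irreducible ϖ) {c : F} (hc : c ≠ 0) :
    (∃ o : O, algebraMap O F o = c) ↔ 0 ≤ ord ϖ c := by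
  obtain ⟨u, hu⟩ := exists_unit_mul_zpow_ord hϖ hc
  rw [← exists_algebraMap_eq_unit_mul_zpow_iff (F := F) hϖ u, ← hu]

theorem ord_unit_mul_zpow (hϖ : Irreducible ϖ) (u : Oˣ) (m : ℤ) :
    ord ϖ (algebraMap O F u * algebraMap O F ϖ ^ m) = m := by
  have hu0 : ∀ w : Oˣ, algebraMap O F w ≠ 0 := fun w => by simp
  have hp : algebraMap O F ϖ ≠ 0 := algebraMap_uniformizer_ne_zero hϖ
  obtain ⟨w, hw⟩ := exists_unit_mul_zpow_ord hϖ
    (mul_ne_zero (hu0 u) (zpow_uniformizer_ne_zero (F := F) hϖ m))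
  set k := ord ϖ (algebraMap O F u * algebraMap O F ϖ ^ m)
  have key : ∀ (u w : Oˣ) (m k : ℤ), algebraMap O F u * algebraMap O F ϖ ^ m =
      algebraMap O F w * algebraMap O F ϖ ^ k → k ≤ m := by
    intro u w m k h
    have := (exists_algebraMap_eq_unit_mul_zpow_iff (F := F) hϖ u (m - k)).1 ⟨w, by
      rw [zpow_sub₀ hp, ← mul_div_assoc, h, mul_div_assoc, div_self (zpow_ne_zero _ hp), mul_one]⟩
    omega
  exact le_antisymm (key _ _ _ _ hw) (key _ _ _ _ hw.symm)

theorem ord_zpow (hϖ : Irreducible ϖ) (m : ℤ) : ord ϖ (algebraMap O F ϖ ^ m) = m := by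
  simpa using ord_unit_mul_zpow (F := F) hϖ 1 m

theorem ord_mul (hϖ : Irreducible ϖ) {c d : F} (hc : c ≠ 0) (hd : d ≠ 0) :
    ord ϖ (c * d) = ord ϖ c + ord ϖ d := by
  obtain ⟨u, hu⟩ := exists_unit_mul_zpow_ord hϖ hc
  obtain ⟨w, hw⟩ := exists_unit_mul_zpow_ord hϖ hd
  conv_lhs => rw [hu, hw]
  rw [mul_mul_mul_comm, ← map_mul, ← zpow_add₀ (algebraMap_uniformizer_ne_zero hϖ),
    ← Units.val_mul, ord_unit_mul_zpow hϖ]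

theorem ord_one (hϖ : Irreducible ϖ) : ord ϖ (1 : F) = 0 := by
  simpa using ord_zpow (F := F) hϖ 0

theorem ord_inv (hϖ : Irreducible ϖ) {c : F} (hc : c ≠ 0) : ord ϖ c⁻¹ = -ord ϖ c := by
  have := ord_mul hϖ hc (inv_ne_zero hc)
  rw [mul_inv_cancel₀ hc, ord_one hϖ] at this
  omega

theorem ord_prod (hϖ : Irreducible ϖ) {ι : Type*} (s : Finset ι) (c : ι → F)
    (hc : ∀ i ∈ s, c i ≠ 0) : ord ϖ (∏ i ∈ s, c i) = ∑ i ∈ s, ord ϖ (c i) := by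
  classical
  induction s using Finset.induction_on with
  | empty => simp [ord_one hϖ]
  | insert a s ha ih =>
    rw [Finset.prod_insert ha, Finset.sum_insert ha, ord_mul hϖ (hc a (by simp))
      (Finset.prod_ne_zero_iff.2 fun i hi => hc i (by simp [hi])),
      ih fun i hi => hc i (by simp [hi])]

/-- The alternative `d = 0` stands for infinite valuation, since `ord` takes the default value 0 at
zero. -/
theorem exists_algebraMap_mul_eq (hϖ : Irreducible ϖ) {c d : F} (hc : c ≠ 0)
    (h : d = 0 ∨ ord ϖ c ≤ ord ϖ d) : ∃ o : O, d = algebraMap O F o * c := by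
  rcases eq_or_ne d 0 with rfl | hd
  · exact ⟨0, by simp⟩
  have h := h.resolve_left hd
  obtain ⟨o, ho⟩ := (exists_algebraMap_eq_iff hϖ (mul_ne_zero hd (inv_ne_zero hc))).2
    (by rw [ord_mul hϖ hd (inv_ne_zero hc), ord_inv hϖ hc]; omega)
  exact ⟨o, by rw [ho, inv_mul_cancel_right₀ hc]⟩

theorem ord_le_ord_algebraMap_mul (hϖ : Irreducible ϖ) (o : O) {c : F} (hc : c ≠ 0) :
    algebraMap O F o * c = 0 ∨ ord ϖ c ≤ ord ϖ (algebraMap O F o * c) := by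
  rcases eq_or_ne (algebraMap O F o) 0 with h | h
  · exact .inl (by rw [h, zero_mul])
  · have := (exists_algebraMap_eq_iff hϖ h).1 ⟨o, rfl⟩
    exact .inr (by rw [ord_mul hϖ h hc]; omega)

theorem smul_mem_of_ord_le {V : Type*} [AddCommGroup V] [Module F V] [Module O V]
    [IsScalarTower O F V] (hϖ : Irreducible ϖ) {Λ : Submodule O V} {c d : F} (hc : c ≠ 0)
    (h : d = 0 ∨ ord ϖ c ≤ ord ϖ d) {x : V} (hx : c • x ∈ Λ) : d • x ∈ Λ := by
  obtain ⟨o, rfl⟩ := exists_algebraMap_mul_eq hϖ hc h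
  rw [mul_smul, algebraMap_smul]
  exact Λ.smul_mem o hx

end Order

/-! ### Lattices adapted to a basis, and the chart of an apartment -/

section BasisLattice

variable {O F V : Type*} [CommRing O] [Field F] [Algebra O F] [AddCommGroup V] [Module F V]
  [Module O V] [IsScalarTower O F V] {n : ℕ}

/-- The `O`-span of the vectors `ϖ ^ v l • b l`. -/
def basisSpan (ϖ : O) (b : Module.Basis (Fin n) F V) (v : Fin n → ℤ) : Submodule O V :=
  Submodule.span O (Set.range fun l => algebraMap O F ϖ ^ v l • b l)

theorem cls_eq_cls_iff {Λ Λ' : Lattice O F V} : cls Λ = cls Λ' ↔ ∃ a : Fˣ, Λ'.1 = a • Λ.1 :=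
  Quotient.eq

/-- The lines spanned by the vectors of a family. -/
def lines {ι : Type*} (e : ι → V) : Set (Submodule F V) :=
  Set.range fun i => Submodule.span F {e i}

variable [IsFractionRing O F] {ϖ : O}

theorem uniformizer_smul_basisSpan (hϖ : Irreducible ϖ) (b : Module.Basis (Fin n) F V)
    (v : Fin n → ℤ) : ϖ • basisSpan ϖ b v = basisSpan ϖ b fun l => v l + 1 := by
  rw [basisSpan, Submodule.smul_span, ← Set.range_smul, basisSpan]
  congr 2
  funext l
  rw [← algebraMap_smul F ϖ (_ • _), smul_smul, ← zpow_one_add₀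
    (algebraMap_uniformizer_ne_zero hϖ), add_comm]

theorem isLattice_basisSpan (hϖ : Irreducible ϖ) (b : Module.Basis (Fin n) F V) (v : Fin n → ℤ) :
    Submodule.IsLattice F (basisSpan ϖ b v) where
  fg := Submodule.fg_span (Set.finite_range _)
  span_eq_top := by
    rw [eq_top_iff, ← b.span_eq, Submodule.span_le]
    rintro _ ⟨l, rfl⟩
    have h : algebraMap O F ϖ ^ v l • b l ∈ Submodule.span F (basisSpan ϖ b v : Set V) :=
      Submodule.subset_span (Submodule.subset_span ⟨l, rfl⟩)
    exact (Submodule.smul_mem_iff _ (zpow_uniformizer_ne_zero hϖ _)).1 h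

variable [IsDomain O] [IsDiscreteValuationRing O]

theorem span_smul_basis (hϖ : Irreducible ϖ) (b : Module.Basis (Fin n) F V) (c : Fin n → F)
    (hc : ∀ l, c l ≠ 0) :
    Submodule.span O (Set.range fun l => c l • b l) = basisSpan ϖ b fun l => ord ϖ (c l) := by
  apply le_antisymm
  · rw [Submodule.span_le]
    rintro _ ⟨l, rfl⟩
    refine smul_mem_of_ord_le hϖ (zpow_uniformizer_ne_zero hϖ (ord ϖ (c l)))
      (.inr (ord_zpow hϖ _).le) ?_
    exact Submodule.subset_span ⟨l, rfl⟩
  · rw [basisSpan, Submodule.span_le]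
    rintro _ ⟨l, rfl⟩
    refine smul_mem_of_ord_le hϖ (hc l) (.inr (ord_zpow hϖ _).ge) ?_
    exact Submodule.subset_span ⟨l, rfl⟩

theorem mem_basisSpan_iff (hϖ : Irreducible ϖ) (b : Module.Basis (Fin n) F V) (v : Fin n → ℤ)
    (x : V) : x ∈ basisSpan ϖ b v ↔ ∀ l, b.repr x l = 0 ∨ v l ≤ ord ϖ (b.repr x l) := by
  constructor
  · intro hx l
    have hp := zpow_uniformizer_ne_zero (F := F) hϖ (v l)
    suffices ∃ o : O, b.repr x l = algebraMap O F o * algebraMap O F ϖ ^ v l by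
      obtain ⟨o, ho⟩ := this
      rw [ho]
      simpa only [ord_zpow hϖ] using ord_le_ord_algebraMap_mul hϖ o hp
    induction hx using Submodule.span_induction with
    | mem x hx =>
      obtain ⟨k, rfl⟩ := hx
      rcases eq_or_ne k l with rfl | h
      · exact ⟨1, by simp⟩
      · exact ⟨0, by simp [h]⟩
    | zero => exact ⟨0, by simp⟩
    | add x y _ _ hx hy =>
      obtain ⟨o, ho⟩ := hx
      obtain ⟨o', ho'⟩ := hy
      exact ⟨o + o', by simp [ho, ho', add_mul]⟩
    | smul a x _ hx =>
      obtain ⟨o, ho⟩ := hx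
      refine ⟨a * o, ?_⟩
      rw [← algebraMap_smul F a x, map_smul, Finsupp.smul_apply, ho, smul_eq_mul, map_mul,
        mul_assoc]
  · intro h
    rw [← b.sum_repr x]
    refine Submodule.sum_mem _ fun l _ => ?_
    refine smul_mem_of_ord_le hϖ (zpow_uniformizer_ne_zero hϖ (v l)) ?_
      (Submodule.subset_span ⟨l, rfl⟩)
    rw [ord_zpow hϖ]
    exact h l

theorem basisSpan_le_iff (hϖ : Irreducible ϖ) (b : Module.Basis (Fin n) F V) (v w : Fin n → ℤ) :
    basisSpan ϖ b v ≤ basisSpan ϖ b w ↔ ∀ l, w l ≤ v l := by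
  constructor
  · intro h l
    have : algebraMap O F ϖ ^ v l • b l ∈ basisSpan ϖ b w := h (Submodule.subset_span ⟨l, rfl⟩)
    have := (mem_basisSpan_iff hϖ b w _).1 this l
    simpa [zpow_uniformizer_ne_zero hϖ, algebraMap_uniformizer_ne_zero hϖ, hϖ.ne_zero, ord_zpow hϖ]
      using this
  · intro h x hx
    rw [mem_basisSpan_iff hϖ] at hx ⊢
    exact fun l => (hx l).imp_right (h l).trans

theorem basisSpan_injective (hϖ : Irreducible ϖ) (b : Module.Basis (Fin n) F V) :
    Function.Injective (basisSpan (V := V) ϖ b) := fun v w h => by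
  funext l
  exact le_antisymm ((basisSpan_le_iff hϖ b w v).1 h.ge l) ((basisSpan_le_iff hϖ b v w).1 h.le l)

theorem units_smul_basisSpan (hϖ : Irreducible ϖ) (b : Module.Basis (Fin n) F V) (v : Fin n → ℤ)
    (a : Fˣ) : a • basisSpan ϖ b v = basisSpan ϖ b fun l => v l + ord ϖ (a : F) := by
  rw [basisSpan, Units.smul_def, Submodule.smul_span, ← Set.range_smul]
  have := span_smul_basis hϖ b (fun l => (a : F) * algebraMap O F ϖ ^ v l)
    fun l => mul_ne_zero a.ne_zero (zpow_uniformizer_ne_zero hϖ _)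
  simp only [ord_mul hϖ a.ne_zero (zpow_uniformizer_ne_zero hϖ _), ord_zpow hϖ] at this
  simp only [add_comm (v _)]
  rw [← this]
  congr 2
  funext l
  exact (mul_smul _ _ _).symm

/-- `basisSpan ϖ b v` as a lattice. -/
def basisLattice (hϖ : Irreducible ϖ) (b : Module.Basis (Fin n) F V) (v : Fin n → ℤ) :
    Lattice O F V :=
  ⟨basisSpan ϖ b v, isLattice_basisSpan hϖ b v⟩

/-- The homothety class of `basisSpan ϖ b v`. -/
def basisVertex (hϖ : Irreducible ϖ) (b : Module.Basis (Fin n) F V) (v : Fin n → ℤ) :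
    Vertex O F V :=
  cls (basisLattice hϖ b v)

/-- A scalar `a` shifts all coordinates by `ord a`, and every integer is such a valuation; so
classes correspond to vectors modulo constants. -/
theorem cls_eq_basisVertex_iff (hϖ : Irreducible ϖ) (b : Module.Basis (Fin n) F V)
    (v : Fin n → ℤ) (Λ : Lattice O F V) :
    cls Λ = basisVertex hϖ b v ↔ ∃ m : ℤ, Λ.1 = basisSpan ϖ b fun l => v l + m := by
  rw [eq_comm, basisVertex, cls_eq_cls_iff]
  constructor
  · rintro ⟨a, ha⟩
    exact ⟨_, ha.trans (units_smul_basisSpan hϖ b v a)⟩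
  · rintro ⟨m, hm⟩
    refine ⟨Units.mk0 _ (zpow_uniformizer_ne_zero hϖ m), ?_⟩
    rw [basisLattice, units_smul_basisSpan hϖ, hm]
    simp [ord_zpow hϖ]

theorem basisVertex_eq_iff (hϖ : Irreducible ϖ) (b : Module.Basis (Fin n) F V)
    (v w : Fin n → ℤ) :
    basisVertex hϖ b v = basisVertex hϖ b w ↔ ∃ m : ℤ, ∀ i, w i = v i + m := by
  rw [eq_comm]
  refine (cls_eq_basisVertex_iff hϖ b v (basisLattice hϖ b w)).trans (exists_congr fun m => ?_)
  rw [basisLattice, (basisSpan_injective hϖ b).eq_iff, funext_iff]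

theorem incident_basisVertex_iff (hϖ : Irreducible ϖ) (b : Module.Basis (Fin n) F V)
    (v w : Fin n → ℤ) : Incident ϖ (basisVertex hϖ b v) (basisVertex hϖ b w) ↔
      SimplicialBuilding.VecIncident v w := by
  constructor
  · rintro ⟨Λ₁, Λ₂, h1, h2, h3, h4⟩
    obtain ⟨m₁, hm₁⟩ := (cls_eq_basisVertex_iff hϖ b v Λ₁).1 h1
    obtain ⟨m₂, hm₂⟩ := (cls_eq_basisVertex_iff hϖ b w Λ₂).1 h2
    rw [hm₁, hm₂, uniformizer_smul_basisSpan hϖ, basisSpan_le_iff hϖ] at h3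
    rw [hm₁, hm₂, basisSpan_le_iff hϖ] at h4
    refine ⟨m₂ - m₁, fun i => ?_⟩
    have := h3 i
    have := h4 i
    omega
  · rintro ⟨m, hm⟩
    refine ⟨basisLattice hϖ b v, basisLattice hϖ b fun l => w l + m, rfl,
      (cls_eq_basisVertex_iff hϖ b w _).2 ⟨m, rfl⟩, ?_, ?_⟩
    · rw [basisLattice, basisLattice, uniformizer_smul_basisSpan hϖ, basisSpan_le_iff hϖ]
      exact fun i => (hm i).2
    · rw [basisLattice, basisLattice, basisSpan_le_iff hϖ]
      exact fun i => (hm i).1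

theorem mem_apartmentVertices_lines_iff (hϖ : Irreducible ϖ) (b : Module.Basis (Fin n) F V)
    (x : Vertex O F V) :
    x ∈ apartmentVertices (lines (F := F) b) ↔ ∃ v, basisVertex hϖ b v = x := by
  constructor
  · rintro ⟨Λ, rfl, e, he, hΛ⟩
    have h : ∀ i, ∃ c : F, c ≠ 0 ∧ e (Submodule.span F {b i}) = c • b i := by
      intro i
      obtain ⟨h1, h2⟩ := he _ ⟨i, rfl⟩
      obtain ⟨c, hc⟩ := Submodule.mem_span_singleton.1 h1
      refine ⟨c, ?_, hc.symm⟩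
      rintro rfl
      exact h2 (by rw [← hc, zero_smul])
    choose c hc hec using h
    refine ⟨fun i => ord ϖ (c i), ((cls_eq_basisVertex_iff hϖ b _ Λ).2 ⟨0, ?_⟩).symm⟩
    simp only [add_zero]
    rw [hΛ, ← span_smul_basis hϖ b c hc, lines, ← Set.range_comp]
    congr 2
    funext i
    exact hec i
  · rintro ⟨v, rfl⟩
    have hinj : Function.Injective fun i => Submodule.span F {b i} :=
      b.linearIndependent.iSupIndep_span_singleton.injective fun i => by simp [b.ne_zero]
    -- The generators must be a function on all subspaces; they are transported along the injection
    -- from indices to lines, with the irrelevant value 0 off the frame.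
    refine ⟨_, rfl, Function.extend (fun i => Submodule.span F {b i})
      (fun i => algebraMap O F ϖ ^ v i • b i) 0, ?_, ?_⟩
    · rintro _ ⟨i, rfl⟩
      rw [hinj.extend_apply]
      exact ⟨Submodule.smul_mem _ _ (Submodule.mem_span_singleton_self _),
        smul_ne_zero (zpow_uniformizer_ne_zero hϖ _) (b.ne_zero i)⟩
    · rw [basisLattice, lines, ← Set.range_comp]
      change Submodule.span O _ = _
      congr 2
      funext i
      rw [Function.comp_apply, hinj.extend_apply]

/-- The bridge between lattices and integer vectors: all combinatorial results apply to apartments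
through it. -/
theorem isAffineChart_basisVertex (hϖ : Irreducible ϖ) (b : Module.Basis (Fin n) F V) :
    SimplicialBuilding.IsAffineChart (apartment ϖ (lines (F := F) b)) (basisVertex hϖ b) where
  eq_iff := basisVertex_eq_iff hϖ b
  mem_faces s := by
    simp only [apartment, building, Set.mem_ofPred_eq, mem_apartmentVertices_lines_iff hϖ b]
    constructor
    · rintro ⟨⟨h1, h2⟩, h3⟩
      exact ⟨h1, h3, fun v w hv hw => (incident_basisVertex_iff hϖ b v w).1 (h2 _ hv _ hw)⟩
    · rintro ⟨h1, h2, h3⟩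
      refine ⟨⟨h1, fun x hx y hy => ?_⟩, h2⟩
      obtain ⟨v, rfl⟩ := h2 x hx
      obtain ⟨w, rfl⟩ := h2 y hy
      exact (incident_basisVertex_iff hϖ b v w).2 (h3 v w hx hy)

end BasisLattice

/-! ### Frames and bases -/

section Frames

variable {F V : Type*} [Field F] [AddCommGroup V] [Module F V]

theorem isFrame_lines {ι : Type*} {e : ι → V} (he : LinearIndependent F e) :
    IsFrame (Submodule.span F (Set.range e)) (lines (F := F) e) where
  finrank_eq_one := by
    rintro _ ⟨i, rfl⟩
    exact finrank_span_singleton (he.ne_zero i)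
  indep := he.iSupIndep_span_singleton.sSupIndep_range
  sSup_eq := by
    rw [lines, sSup_range, Submodule.span_range_eq_iSup]

theorem IsFrame.exists_linearIndependent [Module.Finite F V] {W : Submodule F V}
    {𝓕 : Set (Submodule F V)} (h : IsFrame W 𝓕) :
    ∃ (d : ℕ) (e : Fin d → V), LinearIndependent F e ∧ lines (F := F) e = 𝓕 ∧
      Submodule.span F (Set.range e) = W := by
  have hfin : Finite 𝓕 := WellFoundedGT.finite_of_sSupIndep h.indep
  have hl : ∀ l : 𝓕, ∃ x : V, x ≠ 0 ∧ Submodule.span F {x} = l.1 := by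
    intro l
    obtain ⟨x, hx, hxl⟩ := finrank_eq_one_iff'.1 (h.finrank_eq_one l l.2)
    refine ⟨x, by simpa using hx, le_antisymm ?_ fun y hy => ?_⟩
    · rw [Submodule.span_singleton_le_iff_mem]; exact x.2
    · obtain ⟨c, hc⟩ := hxl ⟨y, hy⟩
      exact Submodule.mem_span_singleton.2 ⟨c, congrArg Subtype.val hc⟩
  choose x hx hxl using hl
  obtain ⟨d, ⟨f⟩⟩ := Finite.exists_equiv_fin 𝓕
  have hli : LinearIndependent F x :=
    iSupIndep.linearIndependent _ ((sSupIndep_iff _).1 h.indep)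
      (fun l => (hxl l) ▸ Submodule.mem_span_singleton_self (x l)) hx
  have hlines : lines (F := F) (x ∘ f.symm) = 𝓕 := by
    have : (fun i => Submodule.span F {(x ∘ f.symm) i}) = Subtype.val ∘ f.symm := by
      funext i; exact hxl _
    rw [lines, this, f.symm.surjective.range_comp, Subtype.range_coe]
  have hli' := hli.comp f.symm f.symm.injective
  refine ⟨d, x ∘ f.symm, hli', hlines, ?_⟩
  rw [← (isFrame_lines hli').sSup_eq, hlines, h.sSup_eq]

theorem IsFrame.exists_basis [Module.Finite F V] {𝓕 : Set (Submodule F V)} (h : IsFrame ⊤ 𝓕) :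
    ∃ b : Module.Basis (Fin (Module.finrank F V)) F V, lines (F := F) b = 𝓕 := by
  obtain ⟨d, e, he, rfl, hspan⟩ := h.exists_linearIndependent
  let b := Module.Basis.mk he hspan.ge
  have hd : d = Module.finrank F V := by
    rw [Module.finrank_eq_card_basis b, Fintype.card_fin]
  subst hd
  exact ⟨b, by simp [b]⟩

theorem IsFrame.union [Module.Finite F V] {W₁ W₂ : Submodule F V} (hW : Disjoint W₁ W₂)
    {𝓕₁ 𝓕₂ : Set (Submodule F V)} (h₁ : IsFrame W₁ 𝓕₁) (h₂ : IsFrame W₂ 𝓕₂) :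
    IsFrame (W₁ ⊔ W₂) (𝓕₁ ∪ 𝓕₂) := by
  obtain ⟨d₁, e₁, he₁, rfl, rfl⟩ := h₁.exists_linearIndependent
  obtain ⟨d₂, e₂, he₂, rfl, rfl⟩ := h₂.exists_linearIndependent
  have := isFrame_lines (he₁.sum_type he₂ hW)
  rw [Set.Sum.elim_range, Submodule.span_union] at this
  convert this using 1
  rw [lines, lines, lines, ← Set.Sum.elim_range]
  congr 1
  funext i
  cases i <;> rfl

end Frames

end LatticeBuilding

/-! ### Change of basis between two apartments -/

namespace LatticeBuilding

section ChangeOfBasis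

variable {O F : Type*} [CommRing O] [Field F] [Algebra O F]
  [IsDomain O] [IsDiscreteValuationRing O] [IsFractionRing O F] {ϖ : O} {n : ℕ}

/-- The ultrametric inequality for the Leibniz expansion. Membership in the fractional ideal
generated by `ϖ ^ d` replaces inequalities of `ord`, which would fail for vanishing terms. -/
theorem le_ord_det (hϖ : Irreducible ϖ) {M : Matrix (Fin n) (Fin n) F} (hM : M.det ≠ 0) {d : ℤ}
    (h : ∀ σ : Equiv.Perm (Fin n), (∀ l, M (σ l) l ≠ 0) → d ≤ ∑ l, ord ϖ (M (σ l) l)) :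
    d ≤ ord ϖ M.det := by
  have hp := zpow_uniformizer_ne_zero (F := F) hϖ d
  have hmem : M.det ∈ Submodule.span O {algebraMap O F ϖ ^ d} := by
    rw [Matrix.det_apply]
    refine Submodule.sum_mem _ fun σ _ => ?_
    have : ∏ l, M (σ l) l ∈ Submodule.span O {algebraMap O F ϖ ^ d} := by
      obtain ⟨o, ho⟩ : ∃ o : O, ∏ l, M (σ l) l = algebraMap O F o * algebraMap O F ϖ ^ d := by
        refine exists_algebraMap_mul_eq hϖ hp ?_
        by_cases h0 : ∀ l, M (σ l) l ≠ 0
        · right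
          rw [ord_prod hϖ _ _ fun l _ => h0 l, ord_zpow hϖ]
          exact h σ h0
        · push Not at h0
          obtain ⟨l, hl⟩ := h0
          exact .inl (Finset.prod_eq_zero (Finset.mem_univ l) hl)
      exact Submodule.mem_span_singleton.2 ⟨o, by rw [ho, Algebra.smul_def]⟩
    rcases Int.units_eq_one_or (Equiv.Perm.sign σ) with h | h
    · rwa [h, one_smul]
    · rw [h, Units.neg_smul, one_smul]
      exact Submodule.neg_mem _ this
  obtain ⟨o, ho⟩ := Submodule.mem_span_singleton.1 hmem
  rw [Algebra.smul_def] at ho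
  have := ord_le_ord_algebraMap_mul hϖ o hp
  rw [ho, ord_zpow hϖ] at this
  exact this.resolve_left hM

theorem exists_perm_sum_ord_le (hϖ : Irreducible ϖ) {M : Matrix (Fin n) (Fin n) F}
    (hM : M.det ≠ 0) : ∃ σ : Equiv.Perm (Fin n), (∀ l, M (σ l) l ≠ 0) ∧
      ∑ l, ord ϖ (M (σ l) l) ≤ ord ϖ M.det := by
  by_contra! h
  have := le_ord_det hϖ hM (d := ord ϖ M.det + 1) h
  omega

variable {V : Type*} [AddCommGroup V] [Module F V] [Module O V] [IsScalarTower O F V]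

theorem le_add_ord_repr (hϖ : Irreducible ϖ) {b b' : Module.Basis (Fin n) F V} {v v' : Fin n → ℤ}
    (h : basisSpan ϖ b' v' ≤ basisSpan ϖ b v) (k l : Fin n) (hkl : b.repr (b' l) k ≠ 0) :
    v k ≤ v' l + ord ϖ (b.repr (b' l) k) := by
  have hp := zpow_uniformizer_ne_zero (F := F) hϖ (v' l)
  have hmem : algebraMap O F ϖ ^ v' l • b' l ∈ basisSpan ϖ b v :=
    h (Submodule.subset_span ⟨l, rfl⟩)
  have := (mem_basisSpan_iff hϖ b v _).1 hmem k
  rw [map_smul, Finsupp.smul_apply, smul_eq_mul, ord_mul hϖ hp hkl, ord_zpow hϖ] at this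
  exact this.resolve_left (mul_ne_zero hp hkl)

theorem det_toMatrix_ne_zero (b b' : Module.Basis (Fin n) F V) : (b.toMatrix b').det ≠ 0 := by
  intro h
  have := congrArg Matrix.det (b.toMatrix_mul_toMatrix_flip b')
  rw [Matrix.det_mul, h, zero_mul, Matrix.det_one] at this
  exact zero_ne_one this

theorem sum_sub_sum_le_ord_det (hϖ : Irreducible ϖ) {b b' : Module.Basis (Fin n) F V}
    {v v' : Fin n → ℤ} (h : basisSpan ϖ b' v' ≤ basisSpan ϖ b v) :
    ∑ l, v l - ∑ l, v' l ≤ ord ϖ (b.toMatrix b').det := by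
  refine le_ord_det hϖ (det_toMatrix_ne_zero b b') fun σ hσ => ?_
  rw [← Equiv.sum_comp σ v, ← Finset.sum_sub_distrib]
  refine Finset.sum_le_sum fun l _ => ?_
  have := le_add_ord_repr hϖ h (σ l) l (hσ l)
  rw [Module.Basis.toMatrix_apply]
  omega

/-- The two inclusions bound the valuations of the determinant and of its inverse from below by
opposite numbers; these valuations add up to 0. -/
theorem ord_det_eq (hϖ : Irreducible ϖ) {b b' : Module.Basis (Fin n) F V}
    {v v' : Fin n → ℤ} (h : basisSpan ϖ b v = basisSpan ϖ b' v') :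
    ord ϖ (b.toMatrix b').det = ∑ l, v l - ∑ l, v' l := by
  have h1 := sum_sub_sum_le_ord_det hϖ h.ge
  have h2 := sum_sub_sum_le_ord_det hϖ h.le
  have h3 := congrArg (fun M => ord ϖ (Matrix.det M)) (b.toMatrix_mul_toMatrix_flip b')
  simp only [Matrix.det_mul, Matrix.det_one, ord_one hϖ,
    ord_mul hϖ (det_toMatrix_ne_zero b b') (det_toMatrix_ne_zero b' b)] at h3
  omega

/-- The coordinates of all lattices that two bases have in common are related by a single
permutation and translation. -/
theorem exists_permShift_eq (hϖ : Irreducible ϖ) (b b' : Module.Basis (Fin n) F V) :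
    ∃ (σ : Equiv.Perm (Fin n)) (c : Fin n → ℤ), ∀ v v' : Fin n → ℤ,
      basisSpan ϖ b v = basisSpan ϖ b' v' → SimplicialBuilding.permShift σ c v = v' := by
  -- The permutation and the translation are read off from the matrix alone, before any lattice is
  -- chosen.
  obtain ⟨σ, hσ, hle⟩ := exists_perm_sum_ord_le hϖ (det_toMatrix_ne_zero b b')
  refine ⟨σ, fun l => ord ϖ (b.toMatrix b' (σ l) l), fun v v' h => ?_⟩
  have h1 : ∀ l ∈ Finset.univ, SimplicialBuilding.permShift σ
      (fun l => ord ϖ (b.toMatrix b' (σ l) l)) v l ≤ v' l := by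
    intro l _
    have := le_add_ord_repr hϖ h.ge (σ l) l (hσ l)
    rw [SimplicialBuilding.permShift, Module.Basis.toMatrix_apply]
    omega
  have h2 : ∑ l, SimplicialBuilding.permShift σ
      (fun l => ord ϖ (b.toMatrix b' (σ l) l)) v l = ∑ l, v' l := by
    refine le_antisymm (Finset.sum_le_sum h1) ?_
    simp only [SimplicialBuilding.permShift, Finset.sum_sub_distrib, Equiv.sum_comp σ v]
    rw [ord_det_eq hϖ h] at hle
    omega
  funext l
  -- Termwise inequalities with equal sums are equalities.
  exact (Finset.sum_eq_sum_iff_of_le h1).1 h2 l (Finset.mem_univ l)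

-- A lattice representing a common vertex has coordinates in both bases, and the map carries one
-- vector to the other. Hence the whole intersection is fixed, not merely two simplices.
open SimplicialBuilding in
theorem exists_isIso_apartment (hϖ : Irreducible ϖ) (b b' : Module.Basis (Fin n) F V) :
    ∃ f, IsIso (apartment ϖ (lines (F := F) b)) (apartment (O := O) ϖ (lines (F := F) b')) f ∧
      ∀ x ∈ apartmentVertices (O := O) (lines (F := F) b),
        x ∈ apartmentVertices (lines (F := F) b') → f x = x := by
  obtain ⟨σ, c, h⟩ := exists_permShift_eq hϖ b b'
  have hP := isAffineChart_basisVertex hϖ b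
  have hP' := isAffineChart_basisVertex hϖ b'
  refine ⟨_, hP.isIso_permShift hP' σ c, fun x hx hx' => ?_⟩
  obtain ⟨v, rfl⟩ := (mem_apartmentVertices_lines_iff hϖ b x).1 hx
  obtain ⟨w, hw⟩ := (mem_apartmentVertices_lines_iff hϖ b' _).1 hx'
  rw [hP.chartMap_permShift_apply hP']
  obtain ⟨m, hm⟩ := (cls_eq_basisVertex_iff hϖ b' w (basisLattice hϖ b v)).1 hw.symm
  rw [h v _ hm, ← hw]
  exact ((basisVertex_eq_iff hϖ b' _ _).2 ⟨m, fun _ => rfl⟩).symm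

end ChangeOfBasis

end LatticeBuilding

/-! ### Splitting lattices along frames -/

namespace LatticeBuilding

/-- A positive entry would make all entries nonnegative and the sum positive. This turns an estimate
summed over a simplex into one for each of its vertices. -/
theorem nonpos_of_sum_nonpos {ι : Type*} [Fintype ι] {D : ι → ℤ} (h : ∀ i j, D i ≤ D j + 1)
    (hs : ∑ i, D i ≤ 0) (i : ι) : D i ≤ 0 := by
  by_contra! hi
  have h0 : ∀ j ∈ Finset.univ, 0 ≤ D j := fun j _ => by have := h i j; omega
  have := Finset.single_le_sum h0 (Finset.mem_univ i)
  omega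

section Splitting

variable {O F V : Type*} [CommRing O] [Field F] [Algebra O F] [AddCommGroup V] [Module F V]
  [Module O V] [IsScalarTower O F V]

/-- The part of `Λ` in `W` is the sum of its parts on the lines in `𝓕`. -/
def SplitsAlong (Λ : Submodule O V) (W : Submodule F V) (𝓕 : Set (Submodule F V)) : Prop :=
  Λ ⊓ W.restrictScalars O ≤ ⨆ l ∈ 𝓕, Λ ⊓ l.restrictScalars O

/-- Both terms of `y = f y • x + (y - f y • x)` stay in `Λ`, and the second lies in the kernel of
`f`. -/
theorem SplitsAlong.insert {Λ : Submodule O V} {H : Submodule F V} {x : V} {f : V →ₗ[F] F}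
    (hx : x ∈ H) (hfx : f x = 1) (hf : ∀ y ∈ H, y ∈ Λ → f y • x ∈ Λ) {𝓕 : Set (Submodule F V)}
    (h : SplitsAlong Λ (H ⊓ LinearMap.ker f) 𝓕) :
    SplitsAlong Λ H (insert (Submodule.span F {x}) 𝓕) := by
  rintro y ⟨hyΛ, hyH⟩
  have hyH : y ∈ H := hyH
  have h1 := hf y hyH hyΛ
  rw [iSup_insert, ← add_sub_cancel (f y • x) y]
  refine Submodule.add_mem_sup ⟨h1, ?_⟩ (h ⟨Λ.sub_mem hyΛ h1, ?_⟩)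
  · exact Submodule.smul_mem _ _ (Submodule.mem_span_singleton_self x)
  · exact ⟨H.sub_mem hyH (H.smul_mem _ hx), by simp [hfx]⟩

theorem splitsAlong_union {ϖ : O} {n : ℕ} (b : Module.Basis (Fin n) F V) (v : Fin n → ℤ)
    {W₁ W₂ : Submodule F V} (hb : ∀ l, b l ∈ W₁ ∨ b l ∈ W₂) {𝓕₁ 𝓕₂ : Set (Submodule F V)}
    (h₁ : SplitsAlong (basisSpan ϖ b v) W₁ 𝓕₁) (h₂ : SplitsAlong (basisSpan ϖ b v) W₂ 𝓕₂) :
    SplitsAlong (basisSpan ϖ b v) ⊤ (𝓕₁ ∪ 𝓕₂) := by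
  rw [SplitsAlong, iSup_union]
  refine inf_le_left.trans (le_trans ?_ (sup_le_sup h₁ h₂))
  conv_lhs => rw [basisSpan]
  rw [Submodule.span_le]
  rintro _ ⟨l, rfl⟩
  have hl : algebraMap O F ϖ ^ v l • b l ∈ basisSpan ϖ b v := Submodule.subset_span ⟨l, rfl⟩
  rcases hb l with h | h
  · exact Submodule.mem_sup_left ⟨hl, W₁.smul_mem _ h⟩
  · exact Submodule.mem_sup_right ⟨hl, W₂.smul_mem _ h⟩

end Splitting

/-! ### Gauges and the common apartment of two simplices -/

section Gauge

variable {O V : Type*} (F : Type*) [CommRing O] [Field F] [Algebra O F] [AddCommGroup V]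
  [Module F V] [Module O V]

/-- `a` gives, for every nonzero `x`, the largest `m` with `x ∈ ϖ ^ m Λ`. -/
def IsGauge (ϖ : O) (Λ : Submodule O V) (a : V → ℤ) : Prop :=
  ∀ x ≠ 0, ∀ c : F, c ≠ 0 → (c • x ∈ Λ ↔ 0 ≤ ord ϖ c + a x)

variable {F} [IsDomain O] [IsDiscreteValuationRing O] [IsFractionRing O F] {ϖ : O} {n : ℕ}

namespace IsGauge

variable {Λ M : Submodule O V} {a b : V → ℤ}

theorem mem_iff (hϖ : Irreducible ϖ) (ha : IsGauge F ϖ Λ a) {x : V} (hx : x ≠ 0) :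
    x ∈ Λ ↔ 0 ≤ a x := by
  have := ha x hx 1 one_ne_zero
  rwa [one_smul, ord_one hϖ, zero_add] at this

theorem zpow_smul_mem (hϖ : Irreducible ϖ) (ha : IsGauge F ϖ Λ a) {x : V} (hx : x ≠ 0) :
    algebraMap O F ϖ ^ (-a x) • x ∈ Λ :=
  (ha x hx _ (zpow_uniformizer_ne_zero hϖ _)).2 (by rw [ord_zpow hϖ]; omega)

theorem le_of_zpow_smul_mem (hϖ : Irreducible ϖ) (ha : IsGauge F ϖ Λ a) {x : V} (hx : x ≠ 0)
    {m : ℤ} (h : algebraMap O F ϖ ^ m • x ∈ Λ) : -m ≤ a x := by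
  have := (ha x hx _ (zpow_uniformizer_ne_zero hϖ _)).1 h
  rw [ord_zpow hϖ] at this
  omega

theorem smul (hϖ : Irreducible ϖ) (ha : IsGauge F ϖ Λ a) {x : V} (hx : x ≠ 0) {c : F}
    (hc : c ≠ 0) : a (c • x) = ord ϖ c + a x := by
  have hcx : c • x ≠ 0 := smul_ne_zero hc hx
  have key : ∀ m : ℤ, 0 ≤ m + a (c • x) ↔ 0 ≤ m + ord ϖ c + a x := by
    intro m
    have h1 := ha (c • x) hcx _ (zpow_uniformizer_ne_zero hϖ m)
    have h2 := ha x hx _ (mul_ne_zero (zpow_uniformizer_ne_zero hϖ m) hc)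
    rw [ord_mul hϖ (zpow_uniformizer_ne_zero hϖ m) hc, ord_zpow hϖ] at h2
    rw [smul_smul, ord_zpow hϖ] at h1
    exact h1.symm.trans h2
  have h1 := (key (-a (c • x))).1 (by omega)
  have h2 := (key (-(ord ϖ c + a x))).2 (by omega)
  omega

theorem le_add (hϖ : Irreducible ϖ) (ha : IsGauge F ϖ Λ a) (hb : IsGauge F ϖ M b) {k : ℤ}
    (h : ∀ x ∈ Λ, algebraMap O F ϖ ^ k • x ∈ M) {x : V} (hx : x ≠ 0) : a x ≤ b x + k := by
  have h1 := h _ (ha.zpow_smul_mem hϖ hx)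
  rw [smul_smul, ← zpow_add₀ (algebraMap_uniformizer_ne_zero hϖ)] at h1
  have := hb.le_of_zpow_smul_mem hϖ hx h1
  omega

end IsGauge

variable [IsScalarTower O F V]

theorem exists_isGauge_basisSpan (hϖ : Irreducible ϖ) (b : Module.Basis (Fin n) F V)
    (v : Fin n → ℤ) : ∃ a, IsGauge F ϖ (basisSpan ϖ b v) a := by
  have : ∀ x : V, ∃ g : ℤ, x ≠ 0 → ∀ c : F, c ≠ 0 →
      (c • x ∈ basisSpan ϖ b v ↔ 0 ≤ ord ϖ c + g) := by
    intro x
    by_cases hx : x = 0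
    · exact ⟨0, fun h => absurd hx h⟩
    obtain ⟨l₀, hl₀⟩ : ∃ l, b.repr x l ≠ 0 := by
      by_contra! h
      exact hx (b.repr.map_eq_zero_iff.1 (Finsupp.ext h))
    -- The gauge is the minimum of `ord (x l) - v l` over the nonzero coordinates of `x`.
    obtain ⟨l, hl, hmin⟩ := Finset.exists_min_image (b.repr x).support
      (fun l => ord ϖ (b.repr x l) - v l) ⟨l₀, Finsupp.mem_support_iff.2 hl₀⟩
    refine ⟨ord ϖ (b.repr x l) - v l, fun _ c hc => ?_⟩
    rw [mem_basisSpan_iff hϖ]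
    simp only [map_smul, Finsupp.smul_apply, smul_eq_mul, mul_eq_zero, hc, false_or]
    rw [Finsupp.mem_support_iff] at hl
    constructor
    · intro h
      have := (h l).resolve_left hl
      rw [ord_mul hϖ hc hl] at this
      omega
    · intro h k
      by_cases hk : b.repr x k = 0
      · exact .inl hk
      · have := hmin k (Finsupp.mem_support_iff.2 hk)
        right
        rw [ord_mul hϖ hc hk]
        omega
  choose a ha using this
  exact ⟨a, fun x hx => ha x hx⟩

theorem zpow_smul_mem_basisSpan (hϖ : Irreducible ϖ) (b : Module.Basis (Fin n) F V)
    {v w : Fin n → ℤ} {k : ℤ} (h : ∀ l, w l ≤ v l + k) {x : V} (hx : x ∈ basisSpan ϖ b v) :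
    algebraMap O F ϖ ^ k • x ∈ basisSpan ϖ b w := by
  have hk := zpow_uniformizer_ne_zero (F := F) hϖ k
  rw [mem_basisSpan_iff hϖ] at hx ⊢
  intro l
  rw [map_smul, Finsupp.smul_apply, smul_eq_mul]
  by_cases hl : b.repr x l = 0
  · exact .inl (by rw [hl, mul_zero])
  · right
    rw [ord_mul hϖ hk hl, ord_zpow hϖ]
    have := (hx l).resolve_left hl
    have := h l
    omega

/-- Finitely many generators need only a bounded power of `ϖ`. This bounds differences of gauges, so
that a maximum exists. -/
theorem exists_zpow_smul_mem (hϖ : Irreducible ϖ) (b : Module.Basis (Fin n) F V)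
    (v : Fin n → ℤ) {M : Submodule O V} {a : V → ℤ} (ha : IsGauge F ϖ M a) :
    ∃ k : ℤ, ∀ x ∈ basisSpan ϖ b v, algebraMap O F ϖ ^ k • x ∈ M := by
  obtain ⟨k, hk⟩ : ∃ k : ℤ, ∀ l, -a (algebraMap O F ϖ ^ v l • b l) ≤ k := by
    obtain ⟨k, hk⟩ := (Set.finite_range fun l => -a (algebraMap O F ϖ ^ v l • b l)).bddAbove
    exact ⟨k, fun l => hk ⟨l, rfl⟩⟩
  refine ⟨k, fun x hx => ?_⟩
  induction hx using Submodule.span_induction with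
  | mem x hx =>
    obtain ⟨l, rfl⟩ := hx
    refine (ha _ (smul_ne_zero (zpow_uniformizer_ne_zero hϖ _) (b.ne_zero l)) _
      (zpow_uniformizer_ne_zero hϖ _)).2 ?_
    rw [ord_zpow hϖ]
    have := hk l
    omega
  | zero => rw [smul_zero]; exact M.zero_mem
  | add x y _ _ hx hy => rw [smul_add]; exact M.add_mem hx hy
  | smul o x _ hx => rw [smul_comm]; exact M.smul_mem o hx

/-- Incidence confines `a - a'` to the two consecutive values `-m` and `1 - m`. -/
theorem gauge_sub_le (hϖ : Irreducible ϖ) (b : Module.Basis (Fin n) F V) {v w : Fin n → ℤ}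
    (h : SimplicialBuilding.VecIncident v w) {a a' : V → ℤ}
    (ha : IsGauge F ϖ (basisSpan ϖ b v) a) (ha' : IsGauge F ϖ (basisSpan ϖ b w) a') {x y : V}
    (hx : x ≠ 0) (hy : y ≠ 0) : a x - a y ≤ a' x - a' y + 1 := by
  obtain ⟨m, hm⟩ := h
  have h1 := ha.le_add hϖ ha' (k := 1 - m) (fun z hz => zpow_smul_mem_basisSpan hϖ b
    (fun l => by have := hm l; omega) hz) hx
  have h2 := ha'.le_add hϖ ha (k := m) (fun z hz => zpow_smul_mem_basisSpan hϖ b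
    (fun l => by have := hm l; omega) hz) hy
  omega

/-- For a simplex of lattices and `x ≠ 0`, a linear form that splits off the line of `x`. -/
theorem exists_splitting_form (hϖ : Irreducible ϖ) (b : Module.Basis (Fin n) F V) {κ : Type*}
    [Fintype κ] (w : κ → Fin n → ℤ) (hw : ∀ i j, SimplicialBuilding.VecIncident (w i) (w j))
    {x : V} (hx : x ≠ 0) : ∃ f : V →ₗ[F] F, f x = 1 ∧
      ∀ j, ∀ y ∈ basisSpan ϖ b (w j), f y • x ∈ basisSpan ϖ b (w j) := by
  obtain ⟨l₀, hl₀⟩ : ∃ l, b.repr x l ≠ 0 := by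
    by_contra! h
    exact hx (b.repr.map_eq_zero_iff.1 (Finsupp.ext h))
  -- A coordinate attaining the gauge of `x` for all `w j` at once is needed. Minimizing the sum
  -- over `j` suffices, since the differences vary by at most one with `j`.
  obtain ⟨l, hl, hmin⟩ := Finset.exists_min_image (b.repr x).support
    (fun l => ∑ j, (ord ϖ (b.repr x l) - w j l)) ⟨l₀, Finsupp.mem_support_iff.2 hl₀⟩
  rw [Finsupp.mem_support_iff] at hl
  refine ⟨(b.repr x l)⁻¹ • b.coord l, by simp [hl], fun j y hy => ?_⟩
  rw [mem_basisSpan_iff hϖ] at hy ⊢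
  intro k
  simp only [LinearMap.smul_apply, Module.Basis.coord_apply, smul_eq_mul, map_smul,
    Finsupp.smul_apply]
  by_cases hk : b.repr x k = 0
  · exact .inl (by rw [hk, mul_zero])
  by_cases hyl : b.repr y l = 0
  · exact .inl (by rw [hyl, mul_zero, zero_mul])
  right
  rw [ord_mul hϖ (mul_ne_zero (inv_ne_zero hl) hyl) hk, ord_mul hϖ (inv_ne_zero hl) hyl,
    ord_inv hϖ hl]
  have h1 := (hy l).resolve_left hyl
  have h2 := nonpos_of_sum_nonpos
    (D := fun j => (ord ϖ (b.repr x l) - w j l) - (ord ϖ (b.repr x k) - w j k))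
    (fun i j => by have := (hw i j).sub_le k l; omega)
    (by
      rw [Finset.sum_sub_distrib]
      have := hmin k (Finsupp.mem_support_iff.2 hk)
      omega) j
  omega

/-- Two simplices of lattices can be split simultaneously along a line in a given subspace. -/
theorem exists_common_splitting_form (hϖ : Irreducible ϖ) (b b' : Module.Basis (Fin n) F V)
    {ι κ : Type*} [Fintype ι] [Fintype κ] [Nonempty κ] (v : ι → Fin n → ℤ) (w : κ → Fin n → ℤ)
    (hv : ∀ i j, SimplicialBuilding.VecIncident (v i) (v j))
    (hw : ∀ i j, SimplicialBuilding.VecIncident (w i) (w j))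
    {H : Submodule F V} (hH : H ≠ ⊥) : ∃ x ∈ H, ∃ f : V →ₗ[F] F, f x = 1 ∧
      (∀ i, ∀ y ∈ H, y ∈ basisSpan ϖ b (v i) → f y • x ∈ basisSpan ϖ b (v i)) ∧
      ∀ j, ∀ y ∈ H, y ∈ basisSpan ϖ b' (w j) → f y • x ∈ basisSpan ϖ b' (w j) := by
  choose a ha using fun i => exists_isGauge_basisSpan hϖ b (v i)
  choose a' ha' using fun j => exists_isGauge_basisSpan hϖ b' (w j)
  -- `Φ` depends only on the line of `x` and is bounded above, so it attains a maximum on the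
  -- nonzero vectors of `H`.
  let Φ : V → ℤ := fun x => ∑ i, ∑ j, (a i x - a' j x)
  have hΦ : ∀ x ≠ 0, ∀ c : F, c ≠ 0 → Φ (c • x) = Φ x := by
    intro x hx c hc
    refine Finset.sum_congr rfl fun i _ => Finset.sum_congr rfl fun j _ => ?_
    rw [(ha i).smul hϖ hx hc, (ha' j).smul hϖ hx hc]
    ring
  obtain ⟨C, hC⟩ : ∃ C, ∀ x ≠ 0, Φ x ≤ C := by
    choose k hk using fun i j => exists_zpow_smul_mem hϖ b (v i) (ha' j)
    refine ⟨∑ i, ∑ j, k i j, fun x hx => Finset.sum_le_sum fun i _ =>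
      Finset.sum_le_sum fun j _ => ?_⟩
    have := (ha i).le_add hϖ (ha' j) (hk i j) hx
    omega
  obtain ⟨x₀, hx₀H, hx₀⟩ := Submodule.exists_mem_ne_zero_of_ne_bot hH
  obtain ⟨_, ⟨x, hxH, hx, rfl⟩, hmax⟩ := Int.exists_greatest_of_bdd
    (P := fun m => ∃ x ∈ H, x ≠ 0 ∧ Φ x = m)
    ⟨C, by rintro _ ⟨x, -, hx, rfl⟩; exact hC x hx⟩ ⟨_, x₀, hx₀H, hx₀, rfl⟩
  obtain ⟨f, hfx, hf⟩ := exists_splitting_form hϖ b' w hw hx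
  refine ⟨x, hxH, f, hfx, fun i y hyH hy => ?_, fun j y _ hy => hf j y hy⟩
  by_cases hfy : f y = 0
  · rw [hfy, zero_smul]
    exact Submodule.zero_mem _
  have hy0 : y ≠ 0 := by rintro rfl; exact hfy (map_zero f)
  have hz0 : f y • x ≠ 0 := smul_ne_zero hfy hx
  have h1 : ∀ j, a' j y ≤ a' j (f y • x) := by
    intro j
    have := hf j _ ((ha' j).zpow_smul_mem hϖ hy0)
    rw [map_smul, smul_eq_mul, mul_smul] at this
    have := (ha' j).le_of_zpow_smul_mem hϖ hz0 this
    omega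
  have h2 : Φ y ≤ Φ (f y • x) := by
    rw [hΦ x hx _ hfy]
    exact hmax _ ⟨y, hyH, hy0, rfl⟩
  -- Passing from `y` to `f y • x` decreases no `a' j` and does not decrease `Φ`, so the sum of the
  -- `a i` cannot drop. The double sum is this sum times the positive cardinality of `κ`.
  have h3 : ∑ i, (a i y - a i (f y • x)) ≤ 0 := by
    have h4 : ∑ i, ∑ _j : κ, (a i y - a i (f y • x)) ≤ 0 := by
      calc ∑ i, ∑ _j : κ, (a i y - a i (f y • x))
          ≤ ∑ i, ∑ j, ((a i y - a' j y) - (a i (f y • x) - a' j (f y • x))) :=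
            Finset.sum_le_sum fun i _ => Finset.sum_le_sum fun j _ => by
              have := h1 j; omega
        _ = Φ y - Φ (f y • x) := by simp only [Φ, Finset.sum_sub_distrib]
        _ ≤ 0 := by omega
    rw [Finset.sum_comm, Finset.sum_const, Finset.card_univ, nsmul_eq_mul] at h4
    have hpos : (0 : ℤ) < Fintype.card κ := by exact_mod_cast Fintype.card_pos
    exact nonpos_of_mul_nonpos_right h4 hpos
  have h4 := nonpos_of_sum_nonpos
    (fun i j => gauge_sub_le hϖ b (hv i j) (ha i) (ha j) hy0 hz0) h3 i
  rw [(ha i).mem_iff hϖ hz0]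
  have := ((ha i).mem_iff hϖ hy0).1 hy
  omega

/-- Induction on dimension: `H` is the sum of the line of `x` and `H ⊓ ker f`, and every lattice
respects this decomposition. -/
theorem exists_frame_splitsAlong [Module.Finite F V] (hϖ : Irreducible ϖ)
    (b b' : Module.Basis (Fin n) F V) {ι κ : Type*} [Fintype ι] [Fintype κ] [Nonempty κ]
    (v : ι → Fin n → ℤ) (w : κ → Fin n → ℤ)
    (hv : ∀ i j, SimplicialBuilding.VecIncident (v i) (v j))
    (hw : ∀ i j, SimplicialBuilding.VecIncident (w i) (w j)) (H : Submodule F V) :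
    ∃ 𝓕, IsFrame H 𝓕 ∧ (∀ i, SplitsAlong (basisSpan ϖ b (v i)) H 𝓕) ∧
      ∀ j, SplitsAlong (basisSpan ϖ b' (w j)) H 𝓕 := by
  induction hd : Module.finrank F H using Nat.strong_induction_on generalizing H with
  | _ d ih =>
  by_cases hH : H = ⊥
  · subst hH
    refine ⟨∅, ⟨by simp, sSupIndep_empty, sSup_empty⟩, fun i => ?_, fun j => ?_⟩ <;>
    simp [SplitsAlong]
  obtain ⟨x, hxH, f, hfx, h1, h2⟩ := exists_common_splitting_form hϖ b b' v w hv hw hH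
  have hxk : x ∉ H ⊓ LinearMap.ker f := fun h => by
    have : f x = 0 := h.2
    exact one_ne_zero (hfx.symm.trans this)
  have hlt : H ⊓ LinearMap.ker f < H :=
    lt_of_le_of_ne inf_le_left fun h => hxk (h.symm ▸ hxH)
  obtain ⟨𝓕, h𝓕, h3, h4⟩ := ih _ (hd ▸ Submodule.finrank_lt_finrank_of_lt hlt) _ rfl
  refine ⟨insert (Submodule.span F {x}) 𝓕, ?_, fun i => (h3 i).insert hxH hfx (h1 i),
    fun j => (h4 j).insert hxH hfx (h2 j)⟩
  have hx0 : x ≠ 0 := by rintro rfl; exact hxk (Submodule.zero_mem _)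
  have hline : IsFrame (Submodule.span F {x}) {Submodule.span F {x}} :=
    ⟨by rintro _ rfl; exact finrank_span_singleton hx0, sSupIndep_singleton _, sSup_singleton⟩
  have := hline.union ((Submodule.disjoint_span_singleton' hx0).2 hxk).symm h𝓕
  rw [Set.singleton_union] at this
  convert this using 1
  refine le_antisymm (fun y hy => ?_) (sup_le ?_ inf_le_left)
  · rw [← add_sub_cancel (f y • x) y]
    refine Submodule.add_mem_sup (Submodule.smul_mem _ _ (Submodule.mem_span_singleton_self x))
      ⟨H.sub_mem hy (H.smul_mem _ hxH), by simp [hfx]⟩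
  · rwa [Submodule.span_singleton_le_iff_mem]

/-- By the gauge, the part of `Λ` on the line of `b l` is generated by `ϖ ^ (-a (b l)) • b l`. -/
theorem exists_eq_basisSpan_of_splitsAlong (hϖ : Irreducible ϖ) (b : Module.Basis (Fin n) F V)
    {Λ : Submodule O V} {a : V → ℤ} (ha : IsGauge F ϖ Λ a)
    (h : SplitsAlong Λ ⊤ (lines (F := F) b)) : ∃ v, Λ = basisSpan ϖ b v := by
  refine ⟨fun l => -a (b l), le_antisymm ?_ ?_⟩
  · refine (le_inf le_rfl fun _ _ => trivial).trans (h.trans (iSup₂_le ?_))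
    rintro _ ⟨l, rfl⟩ y ⟨hyΛ, hy⟩
    obtain ⟨c, rfl⟩ := Submodule.mem_span_singleton.1 hy
    refine smul_mem_of_ord_le hϖ (zpow_uniformizer_ne_zero hϖ (-a (b l))) ?_
      (Submodule.subset_span ⟨l, rfl⟩)
    rw [or_iff_not_imp_left, ord_zpow hϖ]
    intro hc
    have := (ha (b l) (b.ne_zero l) c hc).1 hyΛ
    omega
  · rw [basisSpan, Submodule.span_le]
    rintro _ ⟨l, rfl⟩
    exact ha.zpow_smul_mem hϖ (b.ne_zero l)

theorem mem_or_mem_of_lines_eq {b : Module.Basis (Fin n) F V} {W₁ W₂ : Submodule F V}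
    {𝓕₁ 𝓕₂ : Set (Submodule F V)} (h₁ : IsFrame W₁ 𝓕₁) (h₂ : IsFrame W₂ 𝓕₂)
    (hb : lines (F := F) b = 𝓕₁ ∪ 𝓕₂) (l : Fin n) : b l ∈ W₁ ∨ b l ∈ W₂ := by
  have hl : Submodule.span F {b l} ∈ 𝓕₁ ∪ 𝓕₂ := hb ▸ ⟨l, rfl⟩
  refine hl.imp (fun h => ?_) fun h => ?_
  · exact h₁.sSup_eq ▸ le_sSup h (Submodule.mem_span_singleton_self _)
  · exact h₂.sSup_eq ▸ le_sSup h (Submodule.mem_span_singleton_self _)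

theorem exists_vec_family (hϖ : Irreducible ϖ) {b : Module.Basis (Fin n) F V}
    {s : Finset (Vertex O F V)} (hs : s ∈ (apartment ϖ (lines (F := F) b)).faces) :
    ∃ v : s → Fin n → ℤ, (∀ i, basisVertex hϖ b (v i) = i) ∧
      ∀ i j, SimplicialBuilding.VecIncident (v i) (v j) := by
  obtain ⟨-, h1, h2⟩ := ((isAffineChart_basisVertex hϖ b).mem_faces s).1 hs
  choose v hv using fun i : s => h1 i i.2
  exact ⟨v, hv, fun i j => h2 _ _ (by rw [hv]; exact i.2) (by rw [hv]; exact j.2)⟩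

/-- Any two simplices of the union of the split apartments lie in a common split apartment. -/
theorem exists_common_apartment [Module.Finite F V] (hϖ : Irreducible ϖ) {W₁ W₂ : Submodule F V}
    (hW : IsCompl W₁ W₂) {s t : Finset (Vertex O F V)}
    (hs : s ∈ (splitUnion ϖ W₁ W₂).faces) (ht : t ∈ (splitUnion ϖ W₁ W₂).faces) :
    ∃ 𝓕₁ 𝓕₂ : Set (Submodule F V), IsFrame W₁ 𝓕₁ ∧ IsFrame W₂ 𝓕₂ ∧
      s ∈ (apartment ϖ (𝓕₁ ∪ 𝓕₂)).faces ∧ t ∈ (apartment ϖ (𝓕₁ ∪ 𝓕₂)).faces := by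
  obtain ⟨_, ⟨𝓖₁, 𝓖₂, h𝓖₁, h𝓖₂, rfl⟩, hs⟩ := Set.mem_iUnion₂.1 hs
  obtain ⟨_, ⟨𝓖₁', 𝓖₂', h𝓖₁', h𝓖₂', rfl⟩, ht⟩ := Set.mem_iUnion₂.1 ht
  obtain ⟨b, hb⟩ := (hW.sup_eq_top ▸ h𝓖₁.union hW.disjoint h𝓖₂ : IsFrame ⊤ _).exists_basis
  obtain ⟨b', hb'⟩ := (hW.sup_eq_top ▸ h𝓖₁'.union hW.disjoint h𝓖₂' : IsFrame ⊤ _).exists_basis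
  obtain ⟨v, hvs, hv⟩ := exists_vec_family hϖ (hb ▸ hs)
  obtain ⟨w, hwt, hw⟩ := exists_vec_family hϖ (hb' ▸ ht)
  have : Nonempty t := ht.1.1.to_subtype
  obtain ⟨𝓕₁, h𝓕₁, h₁, h₁'⟩ := exists_frame_splitsAlong hϖ b b' v w hv hw W₁
  obtain ⟨𝓕₂, h𝓕₂, h₂, h₂'⟩ := exists_frame_splitsAlong hϖ b b' v w hv hw W₂
  obtain ⟨B, hB⟩ := (hW.sup_eq_top ▸ h𝓕₁.union hW.disjoint h𝓕₂ : IsFrame ⊤ _).exists_basis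
  -- A lattice that splits along the new frame is spanned by multiples of the vectors of `B`,
  -- whatever basis it was given in.
  have key : ∀ (e : Module.Basis (Fin (Module.finrank F V)) F V) (u : Fin _ → ℤ),
      SplitsAlong (basisSpan ϖ e u) ⊤ (𝓕₁ ∪ 𝓕₂) →
      basisVertex hϖ e u ∈ apartmentVertices (𝓕₁ ∪ 𝓕₂) := by
    intro e u h
    rw [← hB] at h ⊢
    obtain ⟨a, ha⟩ := exists_isGauge_basisSpan hϖ e u
    obtain ⟨z, hz⟩ := exists_eq_basisSpan_of_splitsAlong hϖ B ha h
    refine (mem_apartmentVertices_lines_iff hϖ B _).2 ⟨z, ?_⟩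
    exact congrArg cls (Subtype.ext hz.symm)
  refine ⟨𝓕₁, 𝓕₂, h𝓕₁, h𝓕₂, ⟨hs.1, fun x hx => ?_⟩, ht.1, fun x hx => ?_⟩
  · have hx' : _ = x := hvs ⟨x, hx⟩
    rw [← hx']
    exact key b _ (splitsAlong_union b _ (mem_or_mem_of_lines_eq h𝓖₁ h𝓖₂ hb)
      (h₁ _) (h₂ _))
  · have hx' : _ = x := hwt ⟨x, hx⟩
    rw [← hx']
    exact key b' _ (splitsAlong_union b' _ (mem_or_mem_of_lines_eq h𝓖₁' h𝓖₂' hb')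
      (h₁' _) (h₂' _))

end Gauge

end LatticeBuilding

/-! ### The building axioms for the union -/

namespace LatticeBuilding

section Main

variable {O F V : Type*} [CommRing O] [Field F] [Algebra O F]
  [AddCommGroup V] [Module F V] [Module O V] [IsScalarTower O F V] [Module.Finite F V] {ϖ : O}

theorem exists_isFrame (W : Submodule F V) : ∃ 𝓕, IsFrame W 𝓕 := by
  let b := Module.finBasis F W
  have hli : LinearIndependent F (W.subtype ∘ b) :=
    b.linearIndependent.map' _ (Submodule.ker_subtype W)
  have h := isFrame_lines hli
  rw [Set.range_comp, Submodule.span_image, b.span_eq, Submodule.map_top,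
    Submodule.range_subtype] at h
  exact ⟨_, h⟩

/-- Both summands must be nonzero here: in dimension one an apartment is a single vertex, which is
not thin. -/
theorem two_le_finrank {W₁ W₂ : Submodule F V} (hW : IsCompl W₁ W₂) (hW₁ : W₁ ≠ ⊥)
    (hW₂ : W₂ ≠ ⊥) : 2 ≤ Module.finrank F V := by
  rw [← Submodule.finrank_add_eq_of_isCompl hW]
  have h1 := Submodule.one_le_finrank_iff.2 hW₁
  have h2 := Submodule.one_le_finrank_iff.2 hW₂
  omega

theorem exists_basis_of_mem_splitApartments {W₁ W₂ : Submodule F V} (hW : IsCompl W₁ W₂)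
    {A : PreAbstractSimplicialComplex (Vertex O F V)} (hA : A ∈ splitApartments ϖ W₁ W₂) :
    ∃ b : Module.Basis (Fin (Module.finrank F V)) F V, A = apartment ϖ (lines (F := F) b) := by
  obtain ⟨𝓕₁, 𝓕₂, h₁, h₂, rfl⟩ := hA
  obtain ⟨b, hb⟩ := (hW.sup_eq_top ▸ h₁.union hW.disjoint h₂ : IsFrame ⊤ _).exists_basis
  exact ⟨b, by rw [hb]⟩

variable [IsDomain O] [IsDiscreteValuationRing O] [IsFractionRing O F]

theorem isBuilding_splitUnion (hϖ : Irreducible ϖ) {W₁ W₂ : Submodule F V} (hW : IsCompl W₁ W₂)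
    (hW₁ : W₁ ≠ ⊥) (hW₂ : W₂ ≠ ⊥) :
    SimplicialBuilding.IsBuilding (splitUnion (O := O) ϖ W₁ W₂) (splitApartments ϖ W₁ W₂) where
  nonempty := by
    obtain ⟨𝓕₁, h₁⟩ := exists_isFrame W₁
    obtain ⟨𝓕₂, h₂⟩ := exists_isFrame W₂
    have hA : apartment (O := O) ϖ (𝓕₁ ∪ 𝓕₂) ∈ splitApartments ϖ W₁ W₂ := ⟨_, _, h₁, h₂, rfl⟩
    obtain ⟨b, hb⟩ := exists_basis_of_mem_splitApartments hW hA
    obtain ⟨s, hs⟩ := ((isAffineChart_basisVertex hϖ b).isCoxeterComplex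
      (two_le_finrank hW hW₁ hW₂)).chamberComplex.nonempty
    exact ⟨s, Set.mem_iUnion₂.2 ⟨_, hA, hb ▸ hs⟩⟩
  eq_union := rfl
  coxeter A hA := by
    obtain ⟨b, rfl⟩ := exists_basis_of_mem_splitApartments hW hA
    exact (isAffineChart_basisVertex hϖ b).isCoxeterComplex (two_le_finrank hW hW₁ hW₂)
  common_apartment s hs t ht := by
    obtain ⟨𝓕₁, 𝓕₂, h₁, h₂, hs', ht'⟩ := exists_common_apartment hϖ hW hs ht
    exact ⟨_, ⟨𝓕₁, 𝓕₂, h₁, h₂, rfl⟩, hs', ht'⟩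
  exists_iso A hA A' hA' s t hs ht hs' ht' := by
    obtain ⟨b, rfl⟩ := exists_basis_of_mem_splitApartments hW hA
    obtain ⟨b', rfl⟩ := exists_basis_of_mem_splitApartments hW hA'
    obtain ⟨f, hf, hfix⟩ := exists_isIso_apartment hϖ b b'
    exact ⟨f, hf, fun x hx => hfix x (hs.2 x hx) (hs'.2 x hx),
      fun x hx => hfix x (ht.2 x hx) (ht'.2 x hx)⟩

end Main

end LatticeBuilding

theorem mainTheorem5 {O F V : Type*} [CommRing O] [IsDomain O] [IsDiscreteValuationRing O]
    [Field F] [Algebra O F] [IsFractionRing O F]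
    [AddCommGroup V] [Module F V] [Module O V] [IsScalarTower O F V] [Module.Finite F V]
    (ϖ : O) (hϖ : Irreducible ϖ)
    (W₁ W₂ : Submodule F V) (hW : IsCompl W₁ W₂) (hW₁ : W₁ ≠ ⊥) (hW₂ : W₂ ≠ ⊥) :
    SimplicialBuilding.IsSubbuilding
      (LatticeBuilding.splitUnion ϖ W₁ W₂) (LatticeBuilding.splitApartments ϖ W₁ W₂)
      (LatticeBuilding.building F V ϖ) (LatticeBuilding.apartments F V ϖ) ∧
    ∀ C D : Finset (LatticeBuilding.Vertex O F V),
      SimplicialBuilding.IsChamber (LatticeBuilding.splitUnion ϖ W₁ W₂) C →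
      SimplicialBuilding.IsChamber (LatticeBuilding.splitUnion ϖ W₁ W₂) D →
      ∃ 𝓕₁ 𝓕₂ : Set (Submodule F V),
        LatticeBuilding.IsFrame W₁ 𝓕₁ ∧ LatticeBuilding.IsFrame W₂ 𝓕₂ ∧
        C ∈ (LatticeBuilding.apartment ϖ (𝓕₁ ∪ 𝓕₂)).faces ∧
        D ∈ (LatticeBuilding.apartment ϖ (𝓕₁ ∪ 𝓕₂)).faces := by
  refine ⟨⟨?_, ?_, LatticeBuilding.isBuilding_splitUnion hϖ hW hW₁ hW₂⟩, fun C D hC hD =>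
    LatticeBuilding.exists_common_apartment hϖ hW hC.1 hD.1⟩
  · refine sSup_le ?_
    rintro _ ⟨𝓕₁, 𝓕₂, -, -, rfl⟩ s hs
    exact hs.1
  · rintro _ ⟨𝓕₁, 𝓕₂, h₁, h₂, rfl⟩
    exact ⟨_, hW.sup_eq_top ▸ h₁.union hW.disjoint h₂, rfl⟩
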